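/- Let $0<\rho<1/3$ and $0<\sigma<1/3$, and put $\alpha=\rho^{-1}$. Let $f:[0,1]\to[0,1]$ be $f(y)=\frac{1}{1-(1-1/y)e^{-1}}$ for $y>0$ and $f(0)=0$, let $g_0=f^{-1}:[0,1]\to[0,1]$, and let $g_1(y)=1-\sigma^{-1}y$. In $\mathbb{R}^3$ consider the pairwise disjoint rectangles $$R_1=[0,\rho]\times[0,1]\times\{0\},\quad R_2=[3/4-\rho,3/4]\times[0,\sigma]\times\{0\},\quad R_3=[0,\rho]\times[0,1]\times\{5/6\},$$ and the map $G$ on $R_1\cup R_2\cup R_3$ given by $G(x,y,z)=(\alpha x,g_0(y),0)$ on $R_1$ and on $R_3$, and $G(x,y,z)=(\alpha(3/4-x),g_1(y),5/6)$ on $R_2$. Let $\Lambda=\bigcap_{n\ge0}G^{-n}(R_1\cup R_2\cup R_3)$ be the maximal invariant set, which is compact, and write $G:\Lambda\to\Lambda$ for the restriction. Let $\phi:\Lambda\to\mathbb{R}$ be Hölder continuous with $$\sup\phi-\inf\phi<\tfrac12\log\omega,\qquad \omega=\frac{1+\sqrt5}{2}.$$ Let $\mathcal{L}_\phi:C(\Lambda)\to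 C(\Lambda)$ be the Ruelle–Perron–Frobenius operator on the real continuous functions with the supremum norm, $\mathcal{L}_\phi\psi(x)=\sum_{y\in G^{-1}(x)}e^{\phi(y)}\psi(y)$, let $\mathcal{L}_\phi^*$ be its dual acting on finite Borel measures on $\Lambda$ by $\int\psi\,d\mathcal{L}_\phi^*\eta=\int\mathcal{L}_\phi\psi\,d\eta$ for all $\psi\in C(\Lambda)$, and let $\lambda=\limsup_{n\to\infty}\|\mathcal{L}_\phi^n\|^{1/n}$ be the spectral radius of $\mathcal{L}_\phi$. Then there exist a Borel probability measure $\nu$ on $\Lambda$ and a function $h:\Lambda\to\mathbb{R}$ that is Hölder continuous (for some exponent in $(0,1]$) and satisfies $h(x)>0$ for every $x\in\Lambda$, such that $$\mathcal{L}_\phi^*\nu=\lambda\nu\qquad\text{and}\qquad\mathcal{L}_\phi h=\lambda h.$$ -/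

import Mathlib

namespace HorseshoeProjection

/-- The parameters of the map: the contraction rate `ρ` of the stable direction and the slope `σ`
of the orientation reversing branch in the central direction. -/
structure Params where
  ρ : ℝ
  σ : ℝ
  ρ_pos : 0 < ρ
  ρ_lt : ρ < 1 / 3
  σ_pos : 0 < σ
  σ_lt : σ < 1 / 3

/-- `f y = 1 / (1 - (1 - 1 / y) e⁻¹)`, extended by continuity by `f 0 = 0`. -/
noncomputable def f (y : ℝ) : ℝ :=
  if y = 0 then 0 else 1 / (1 - (1 - 1 / y) * Real.exp (-1))

/-- The inverse of `f : [0, 1] → [0, 1]`, in closed form (see `invOn_g₀_f`). -/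
noncomputable def g₀ (y : ℝ) : ℝ := y / (Real.exp 1 - (Real.exp 1 - 1) * y)

/-- `f` in closed form on all of `[0, 1]`. -/
theorem f_eq {y : ℝ} (hy : 0 ≤ y) :
    f y = Real.exp 1 * y / (1 + (Real.exp 1 - 1) * y) := by
  have he : 1 < Real.exp 1 := by simp
  unfold f
  split_ifs with h
  · simp [h]
  · have hy' : 0 < y := lt_of_le_of_ne hy (Ne.symm h)
    have h1 : 0 < 1 + (Real.exp 1 - 1) * y := by nlinarith
    rw [Real.exp_neg]
    have h2 : 1 - (1 - 1 / y) * (Real.exp 1)⁻¹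
        = (1 + (Real.exp 1 - 1) * y) / (Real.exp 1 * y) := by
      field_simp
      ring
    rw [h2, one_div_div]

theorem den_g₀_pos {y : ℝ} (hy : y ∈ Set.Icc (0 : ℝ) 1) :
    0 < Real.exp 1 - (Real.exp 1 - 1) * y := by
  have he : 1 < Real.exp 1 := by simp
  nlinarith [hy.1, hy.2]

theorem den_f_pos {y : ℝ} (hy : y ∈ Set.Icc (0 : ℝ) 1) :
    0 < 1 + (Real.exp 1 - 1) * y := by
  have he : 1 < Real.exp 1 := by simp
  nlinarith [hy.1, hy.2]

theorem mapsTo_f : Set.MapsTo f (Set.Icc 0 1) (Set.Icc 0 1) := by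
  intro y hy
  have he : 1 < Real.exp 1 := by simp
  have h := den_f_pos hy
  rw [f_eq hy.1]
  refine ⟨div_nonneg (mul_nonneg (by linarith) hy.1) h.le, ?_⟩
  rw [div_le_one h]
  linarith [hy.2]

theorem mapsTo_g₀ : Set.MapsTo g₀ (Set.Icc 0 1) (Set.Icc 0 1) := by
  intro y hy
  have he : 1 < Real.exp 1 := by simp
  have h := den_g₀_pos hy
  refine ⟨div_nonneg hy.1 h.le, ?_⟩
  unfold g₀
  rw [div_le_one h]
  nlinarith [hy.2]

/-- `g₀` is the inverse function of `f` on `[0, 1]`. -/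
theorem invOn_g₀_f : Set.InvOn g₀ f (Set.Icc 0 1) (Set.Icc 0 1) := by
  have he : 1 < Real.exp 1 := by simp
  refine ⟨fun y hy => ?_, fun y hy => ?_⟩
  · have h := den_f_pos hy
    have h2 := den_g₀_pos (mapsTo_f hy)
    rw [f_eq hy.1] at h2 ⊢
    unfold g₀
    rw [div_eq_iff h2.ne']
    have hq := div_mul_cancel₀ (Real.exp 1 * y) h.ne'
    linear_combination hq
  · have h := den_g₀_pos hy
    have h2 := den_f_pos (mapsTo_g₀ hy)
    rw [f_eq (mapsTo_g₀ hy).1]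
    unfold g₀ at h2 ⊢
    rw [div_eq_iff h2.ne']
    have hq := div_mul_cancel₀ y h.ne'
    linear_combination hq

theorem continuousOn_f : ContinuousOn f (Set.Icc 0 1) := by
  have : ContinuousOn (fun y : ℝ => Real.exp 1 * y / (1 + (Real.exp 1 - 1) * y))
      (Set.Icc 0 1) :=
    ContinuousOn.div (by fun_prop) (by fun_prop) (fun y hy => (den_f_pos hy).ne')
  exact this.congr fun y hy => f_eq hy.1

theorem continuousOn_g₀ : ContinuousOn g₀ (Set.Icc 0 1) :=
  ContinuousOn.div (by fun_prop) (by fun_prop) (fun _ hy => (den_g₀_pos hy).ne')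

variable (P : Params)

/-- The affine branch `g₁ y = 1 - σ⁻¹ y`. -/
noncomputable def g₁ (y : ℝ) : ℝ := 1 - P.σ⁻¹ * y

/-- The rectangle `R₁ = [0, ρ] × [0, 1] × {0}`. -/
def R₁ : Set (ℝ × ℝ × ℝ) := Set.Icc 0 P.ρ ×ˢ Set.Icc 0 1 ×ˢ {0}

/-- The rectangle `R₂ = [3/4 - ρ, 3/4] × [0, σ] × {0}`. -/
def R₂ : Set (ℝ × ℝ × ℝ) := Set.Icc (3 / 4 - P.ρ) (3 / 4) ×ˢ Set.Icc 0 P.σ ×ˢ {0}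

/-- The rectangle `R₃ = [0, ρ] × [0, 1] × {5/6}`. -/
def R₃ : Set (ℝ × ℝ × ℝ) := Set.Icc 0 P.ρ ×ˢ Set.Icc 0 1 ×ˢ {5 / 6}

/-- The union of the three rectangles, the domain of the piecewise map. -/
def R : Set (ℝ × ℝ × ℝ) := R₁ P ∪ R₂ P ∪ R₃ P

open Classical in
/-- The piecewise map, with `α = ρ⁻¹`. The value off the three rectangles plays no role. -/
noncomputable def Gmap (p : ℝ × ℝ × ℝ) : ℝ × ℝ × ℝ :=
  if p ∈ R₁ P then (P.ρ⁻¹ * p.1, g₀ p.2.1, 0)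
  else if p ∈ R₂ P then (P.ρ⁻¹ * (3 / 4 - p.1), g₁ P p.2.1, 5 / 6)
  else if p ∈ R₃ P then (P.ρ⁻¹ * p.1, g₀ p.2.1, 0)
  else p

/-- The maximal invariant set: the points whose forward orbit never leaves the rectangles. -/
def Lam : Set (ℝ × ℝ × ℝ) := ⋂ n : ℕ, (Gmap P)^[n] ⁻¹' R P

variable {P}

theorem mem_Lam {p : ℝ × ℝ × ℝ} : p ∈ Lam P ↔ ∀ n, (Gmap P)^[n] p ∈ R P := by
  simp [Lam]

theorem mem_R_of_mem_Lam {p : ℝ × ℝ × ℝ} (hp : p ∈ Lam P) : p ∈ R P := mem_Lam.1 hp 0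

theorem mem_Lam_iff {p : ℝ × ℝ × ℝ} : p ∈ Lam P ↔ p ∈ R P ∧ Gmap P p ∈ Lam P := by
  simp only [mem_Lam]
  constructor
  · exact fun h => ⟨h 0, fun n => h (n + 1)⟩
  · rintro ⟨h0, h⟩ n
    cases n with
    | zero => exact h0
    | succ n => exact h n

theorem mapsTo_Gmap : Set.MapsTo (Gmap P) (Lam P) (Lam P) := fun _ hp => (mem_Lam_iff.1 hp).2

variable (P)

/-- The map `G : Λ → Λ`. -/
noncomputable def G : Lam P → Lam P := mapsTo_Gmap.restrict (Gmap P) (Lam P) (Lam P)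

variable {P}

theorem Gmap_R₁ {p : ℝ × ℝ × ℝ} (h : p ∈ R₁ P) :
    Gmap P p = (P.ρ⁻¹ * p.1, g₀ p.2.1, 0) := by
  simp [Gmap, h]

theorem Gmap_R₂ {p : ℝ × ℝ × ℝ} (h : p ∈ R₂ P) :
    Gmap P p = (P.ρ⁻¹ * (3 / 4 - p.1), g₁ P p.2.1, 5 / 6) := by
  have h1 : p ∉ R₁ P := fun h1 => by
    have := P.ρ_lt
    linarith [h.1.1, h1.1.2]
  simp [Gmap, h, h1]

theorem Gmap_R₃ {p : ℝ × ℝ × ℝ} (h : p ∈ R₃ P) :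
    Gmap P p = (P.ρ⁻¹ * p.1, g₀ p.2.1, 0) := by
  have hz : p.2.2 = 5 / 6 := h.2.2
  have h1 : p ∉ R₁ P := fun h1 => by
    have hz' : p.2.2 = 0 := h1.2.2
    norm_num [hz] at hz'
  have h2 : p ∉ R₂ P := fun h1 => by
    have hz' : p.2.2 = 0 := h1.2.2
    norm_num [hz] at hz'
  simp [Gmap, h, h1, h2]

theorem isClosed_R₁ : IsClosed (R₁ P) := isClosed_Icc.prod (isClosed_Icc.prod isClosed_singleton)
theorem isClosed_R₂ : IsClosed (R₂ P) := isClosed_Icc.prod (isClosed_Icc.prod isClosed_singleton)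
theorem isClosed_R₃ : IsClosed (R₃ P) := isClosed_Icc.prod (isClosed_Icc.prod isClosed_singleton)

theorem isCompact_R : IsCompact (R P) :=
  ((isCompact_Icc.prod (isCompact_Icc.prod isCompact_singleton)).union
    (isCompact_Icc.prod (isCompact_Icc.prod isCompact_singleton))).union
    (isCompact_Icc.prod (isCompact_Icc.prod isCompact_singleton))

theorem continuousOn_Gmap : ContinuousOn (Gmap P) (R P) := by
  have h1 : ContinuousOn (Gmap P) (R₁ P) := by
    have : ContinuousOn (fun p : ℝ × ℝ × ℝ => (P.ρ⁻¹ * p.1, g₀ p.2.1, (0 : ℝ))) (R₁ P) := by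
      refine ContinuousOn.prodMk (by fun_prop) (ContinuousOn.prodMk ?_ (by fun_prop))
      exact continuousOn_g₀.comp (by fun_prop) (fun p hp => hp.2.1)
    exact this.congr fun p hp => Gmap_R₁ hp
  have h2 : ContinuousOn (Gmap P) (R₂ P) := by
    have : ContinuousOn
        (fun p : ℝ × ℝ × ℝ => (P.ρ⁻¹ * (3 / 4 - p.1), g₁ P p.2.1, (5 / 6 : ℝ))) (R₂ P) := by
      unfold g₁
      fun_prop
    exact this.congr fun p hp => Gmap_R₂ hp
  have h3 : ContinuousOn (Gmap P) (R₃ P) := by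
    have : ContinuousOn (fun p : ℝ × ℝ × ℝ => (P.ρ⁻¹ * p.1, g₀ p.2.1, (0 : ℝ))) (R₃ P) := by
      refine ContinuousOn.prodMk (by fun_prop) (ContinuousOn.prodMk ?_ (by fun_prop))
      exact continuousOn_g₀.comp (by fun_prop) (fun p hp => hp.2.1)
    exact this.congr fun p hp => Gmap_R₃ hp
  exact (h1.union_of_isClosed h2 isClosed_R₁ isClosed_R₂).union_of_isClosed h3
    (isClosed_R₁.union isClosed_R₂) isClosed_R₃

theorem isCompact_Lam : IsCompact (Lam P) := by
  have key : ∀ n : ℕ, IsClosed {p | ∀ k ≤ n, (Gmap P)^[k] p ∈ R P} := by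
    intro n
    induction n with
    | zero => simpa using isCompact_R.isClosed
    | succ n ih =>
      have : {p | ∀ k ≤ n + 1, (Gmap P)^[k] p ∈ R P}
          = R P ∩ Gmap P ⁻¹' {p | ∀ k ≤ n, (Gmap P)^[k] p ∈ R P} := by
        ext p
        constructor
        · exact fun h => ⟨h 0 (by omega), fun k hk => h (k + 1) (by omega)⟩
        · rintro ⟨h0, h⟩ k hk
          cases k with
          | zero => exact h0
          | succ k => exact h k (by omega)
      rw [this]
      exact continuousOn_Gmap.preimage_isClosed_of_isClosed isCompact_R.isClosed ih
  have hc : IsClosed (Lam P) := by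
    have : Lam P = ⋂ n : ℕ, {p | ∀ k ≤ n, (Gmap P)^[k] p ∈ R P} := by
      ext p
      simp only [mem_Lam, Set.mem_iInter, Set.mem_ofPred_eq]
      exact ⟨fun h n k _ => h k, fun h n => h n n le_rfl⟩
    rw [this]
    exact isClosed_iInter key
  exact isCompact_R.of_isClosed_subset hc fun _ hp => mem_R_of_mem_Lam hp

instance : CompactSpace (Lam P) := isCompact_iff_compactSpace.1 isCompact_Lam

/-- The transfer operator on functions: `x ↦ ∑ exp (φ y) ψ y` over the preimages `y` of `x`. -/
noncomputable def transferFun (φ ψ : Lam P → ℝ) (x : Lam P) : ℝ :=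
  ∑ᶠ y ∈ G P ⁻¹' {x}, Real.exp (φ y) * ψ y

/-! ### The transfer operator is a bounded operator on continuous functions -/

/-- The lower plane, as a subset of `Λ`. -/
def low (P : Params) : Set (Lam P) := {p | p.1.2.2 = 0}

theorem z_cases (p : Lam P) : p.1.2.2 = 0 ∨ p.1.2.2 = 5 / 6 := by
  rcases mem_R_of_mem_Lam p.2 with (h | h) | h
  · exact Or.inl h.2.2
  · exact Or.inl h.2.2
  · exact Or.inr h.2.2

theorem x_mem (p : Lam P) : p.1.1 ∈ Set.Icc (0 : ℝ) 1 := by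
  have h1 := P.ρ_pos
  have h2 := P.ρ_lt
  rcases mem_R_of_mem_Lam p.2 with (h | h) | h
  · exact ⟨h.1.1, by linarith [h.1.2]⟩
  · exact ⟨by linarith [h.1.1], by linarith [h.1.2]⟩
  · exact ⟨h.1.1, by linarith [h.1.2]⟩

theorem y_mem (p : Lam P) : p.1.2.1 ∈ Set.Icc (0 : ℝ) 1 := by
  have h2 := P.σ_lt
  rcases mem_R_of_mem_Lam p.2 with (h | h) | h
  · exact h.2.1
  · exact ⟨h.2.1.1, by linarith [h.2.1.2]⟩
  · exact h.2.1

theorem isClopen_low : IsClopen (low P) := by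
  have hcont : Continuous fun p : Lam P => p.1.2.2 := by fun_prop
  refine ⟨isClosed_eq hcont continuous_const, ?_⟩
  have : low P = {p : Lam P | p.1.2.2 < 1 / 2} := by
    ext p
    rcases z_cases p with h | h <;> norm_num [low, h]
  rw [this]
  exact isOpen_lt hcont continuous_const

theorem rho_mul_mem (p : Lam P) : P.ρ * p.1.1 ∈ Set.Icc 0 P.ρ :=
  ⟨mul_nonneg P.ρ_pos.le (x_mem p).1, by nlinarith [P.ρ_pos, (x_mem p).2]⟩

theorem mem_b₁ (p : Lam P) : (P.ρ * p.1.1, f p.1.2.1, (0 : ℝ)) ∈ R₁ P :=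
  ⟨rho_mul_mem p, mapsTo_f (y_mem p), rfl⟩

theorem mem_b₃ (p : Lam P) : (P.ρ * p.1.1, f p.1.2.1, (5 / 6 : ℝ)) ∈ R₃ P :=
  ⟨rho_mul_mem p, mapsTo_f (y_mem p), rfl⟩

theorem mem_b₂ (p : Lam P) :
    (3 / 4 - P.ρ * p.1.1, P.σ * (1 - p.1.2.1), (0 : ℝ)) ∈ R₂ P := by
  have h := rho_mul_mem p
  have hy := y_mem p
  have hs := P.σ_pos
  refine ⟨⟨?_, ?_⟩, ⟨?_, ?_⟩, rfl⟩
  · show 3 / 4 - P.ρ ≤ 3 / 4 - P.ρ * p.1.1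
    linarith [h.2]
  · show 3 / 4 - P.ρ * p.1.1 ≤ 3 / 4
    linarith [h.1]
  · exact mul_nonneg hs.le (by linarith [hy.2])
  · show P.σ * (1 - p.1.2.1) ≤ P.σ
    nlinarith [hy.1]

theorem Gmap_b₁ {p : Lam P} (hp : p ∈ low P) :
    Gmap P (P.ρ * p.1.1, f p.1.2.1, (0 : ℝ)) = p.1 := by
  rw [Gmap_R₁ (mem_b₁ p)]
  refine Prod.ext ?_ (Prod.ext ?_ ?_)
  · simp [P.ρ_pos.ne']
  · exact invOn_g₀_f.1 (y_mem p)
  · exact (show p.1.2.2 = 0 from hp).symm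

theorem Gmap_b₃ {p : Lam P} (hp : p ∈ low P) :
    Gmap P (P.ρ * p.1.1, f p.1.2.1, (5 / 6 : ℝ)) = p.1 := by
  rw [Gmap_R₃ (mem_b₃ p)]
  refine Prod.ext ?_ (Prod.ext ?_ ?_)
  · simp [P.ρ_pos.ne']
  · exact invOn_g₀_f.1 (y_mem p)
  · exact (show p.1.2.2 = 0 from hp).symm

theorem Gmap_b₂ {p : Lam P} (hp : p ∉ low P) :
    Gmap P (3 / 4 - P.ρ * p.1.1, P.σ * (1 - p.1.2.1), (0 : ℝ)) = p.1 := by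
  rw [Gmap_R₂ (mem_b₂ p)]
  refine Prod.ext ?_ (Prod.ext ?_ ?_)
  · simp [P.ρ_pos.ne']
  · simp [g₁, P.σ_pos.ne']
  · exact ((z_cases p).resolve_left hp).symm

open Classical in
/-- The inverse branch onto `R₁`, defined on the lower plane (and the identity elsewhere). -/
noncomputable def b₁ (p : Lam P) : Lam P :=
  if hp : p ∈ low P then ⟨(P.ρ * p.1.1, f p.1.2.1, 0),
    mem_Lam_iff.2 ⟨Or.inl (Or.inl (mem_b₁ p)), by rw [Gmap_b₁ hp]; exact p.2⟩⟩ else p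

open Classical in
/-- The inverse branch onto `R₃`, defined on the lower plane (and the identity elsewhere). -/
noncomputable def b₃ (p : Lam P) : Lam P :=
  if hp : p ∈ low P then ⟨(P.ρ * p.1.1, f p.1.2.1, 5 / 6),
    mem_Lam_iff.2 ⟨Or.inr (mem_b₃ p), by rw [Gmap_b₃ hp]; exact p.2⟩⟩ else p

open Classical in
/-- The inverse branch onto `R₂`, defined on the upper plane (and the identity elsewhere). -/
noncomputable def b₂ (p : Lam P) : Lam P :=
  if hp : p ∈ low P then p else ⟨(3 / 4 - P.ρ * p.1.1, P.σ * (1 - p.1.2.1), 0),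
    mem_Lam_iff.2 ⟨Or.inl (Or.inr (mem_b₂ p)), by rw [Gmap_b₂ hp]; exact p.2⟩⟩

theorem b₁_val {p : Lam P} (hp : p ∈ low P) : (b₁ p).1 = (P.ρ * p.1.1, f p.1.2.1, 0) := by
  simp [b₁, hp]

theorem b₃_val {p : Lam P} (hp : p ∈ low P) :
    (b₃ p).1 = (P.ρ * p.1.1, f p.1.2.1, 5 / 6) := by
  simp [b₃, hp]

theorem b₂_val {p : Lam P} (hp : p ∉ low P) :
    (b₂ p).1 = (3 / 4 - P.ρ * p.1.1, P.σ * (1 - p.1.2.1), 0) := by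
  simp [b₂, hp]

theorem continuous_f_comp : Continuous fun p : Lam P => f p.1.2.1 :=
  continuousOn_f.comp_continuous (by fun_prop) y_mem

theorem continuous_b₁ : Continuous (b₁ : Lam P → Lam P) := by
  classical
  refine Topology.IsInducing.subtypeVal.continuous_iff.2 ?_
  have : (Subtype.val ∘ b₁ : Lam P → _)
      = fun p => if p ∈ low P then (P.ρ * p.1.1, f p.1.2.1, 0) else p.1 := by
    funext p
    by_cases hp : p ∈ low P <;> simp [b₁, hp]
  rw [this]
  refine Continuous.if (fun p hp => ?_) ?_ continuous_subtype_val
  · change p ∈ frontier (low P) at hp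
    simp [isClopen_low.frontier_eq] at hp
  · have := continuous_f_comp (P := P)
    fun_prop

theorem continuous_b₃ : Continuous (b₃ : Lam P → Lam P) := by
  classical
  refine Topology.IsInducing.subtypeVal.continuous_iff.2 ?_
  have : (Subtype.val ∘ b₃ : Lam P → _)
      = fun p => if p ∈ low P then (P.ρ * p.1.1, f p.1.2.1, 5 / 6) else p.1 := by
    funext p
    by_cases hp : p ∈ low P <;> simp [b₃, hp]
  rw [this]
  refine Continuous.if (fun p hp => ?_) ?_ continuous_subtype_val
  · change p ∈ frontier (low P) at hp
    simp [isClopen_low.frontier_eq] at hp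
  · have := continuous_f_comp (P := P)
    fun_prop

theorem continuous_b₂ : Continuous (b₂ : Lam P → Lam P) := by
  classical
  refine Topology.IsInducing.subtypeVal.continuous_iff.2 ?_
  have : (Subtype.val ∘ b₂ : Lam P → _) = fun p => if p ∈ low P then p.1 else
      (3 / 4 - P.ρ * p.1.1, P.σ * (1 - p.1.2.1), 0) := by
    funext p
    by_cases hp : p ∈ low P <;> simp [b₂, hp]
  rw [this]
  refine Continuous.if (fun p hp => ?_) continuous_subtype_val ?_
  · change p ∈ frontier (low P) at hp
    simp [isClopen_low.frontier_eq] at hp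
  · fun_prop

theorem b₁_ne_b₃ {p : Lam P} (hp : p ∈ low P) : b₁ p ≠ b₃ p := by
  intro h
  have := congrArg Subtype.val h
  rw [b₁_val hp, b₃_val hp] at this
  norm_num at this

/-- A point of the lower plane has exactly two preimages. -/
theorem preimage_low {p : Lam P} (hp : p ∈ low P) : G P ⁻¹' {p} = {b₁ p, b₃ p} := by
  have hz : p.1.2.2 = 0 := hp
  ext q
  simp only [Set.mem_preimage, Set.mem_singleton_iff, Set.mem_insert_iff]
  constructor
  · rintro rfl
    change (Gmap P q.1).2.2 = 0 at hz
    rcases mem_R_of_mem_Lam q.2 with (h | h) | h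
    · left
      apply Subtype.ext
      rw [b₁_val hp]
      change q.1 = (P.ρ * (Gmap P q.1).1, f (Gmap P q.1).2.1, 0)
      rw [Gmap_R₁ h]
      exact Prod.ext (by simp [P.ρ_pos.ne'])
        (Prod.ext (invOn_g₀_f.2 h.2.1).symm h.2.2)
    · rw [Gmap_R₂ h] at hz
      norm_num at hz
    · right
      apply Subtype.ext
      rw [b₃_val hp]
      change q.1 = (P.ρ * (Gmap P q.1).1, f (Gmap P q.1).2.1, 5 / 6)
      rw [Gmap_R₃ h]
      exact Prod.ext (by simp [P.ρ_pos.ne'])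
        (Prod.ext (invOn_g₀_f.2 h.2.1).symm h.2.2)
  · rintro (rfl | rfl)
    · apply Subtype.ext
      change Gmap P (b₁ p).1 = p.1
      rw [b₁_val hp, Gmap_b₁ hp]
    · apply Subtype.ext
      change Gmap P (b₃ p).1 = p.1
      rw [b₃_val hp, Gmap_b₃ hp]

/-- A point of the upper plane has exactly one preimage. -/
theorem preimage_up {p : Lam P} (hp : p ∉ low P) : G P ⁻¹' {p} = {b₂ p} := by
  ext q
  simp only [Set.mem_preimage, Set.mem_singleton_iff]
  constructor
  · rintro rfl
    have hz : (Gmap P q.1).2.2 ≠ 0 := hp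
    rcases mem_R_of_mem_Lam q.2 with (h | h) | h
    · rw [Gmap_R₁ h] at hz
      exact absurd rfl hz
    · apply Subtype.ext
      rw [b₂_val hp]
      change q.1 = (3 / 4 - P.ρ * (Gmap P q.1).1, P.σ * (1 - (Gmap P q.1).2.1), 0)
      rw [Gmap_R₂ h]
      exact Prod.ext (by simp [P.ρ_pos.ne'])
        (Prod.ext (by simp [g₁, P.σ_pos.ne']) h.2.2)
    · rw [Gmap_R₃ h] at hz
      exact absurd rfl hz
  · rintro rfl
    apply Subtype.ext
    change Gmap P (b₂ p).1 = p.1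
    rw [b₂_val hp, Gmap_b₂ hp]

theorem transferFun_low (φ ψ : Lam P → ℝ) {p : Lam P} (hp : p ∈ low P) :
    transferFun φ ψ p
      = Real.exp (φ (b₁ p)) * ψ (b₁ p) + Real.exp (φ (b₃ p)) * ψ (b₃ p) := by
  rw [transferFun, preimage_low hp]
  exact finsum_mem_pair (b₁_ne_b₃ hp)

theorem transferFun_up (φ ψ : Lam P → ℝ) {p : Lam P} (hp : p ∉ low P) :
    transferFun φ ψ p = Real.exp (φ (b₂ p)) * ψ (b₂ p) := by
  rw [transferFun, preimage_up hp]
  exact finsum_mem_singleton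

theorem continuous_transferFun (φ ψ : C(Lam P, ℝ)) : Continuous (transferFun φ ψ) := by
  classical
  have h : transferFun φ ψ = fun p => if p ∈ low P then
      Real.exp (φ (b₁ p)) * ψ (b₁ p) + Real.exp (φ (b₃ p)) * ψ (b₃ p)
      else Real.exp (φ (b₂ p)) * ψ (b₂ p) := by
    funext p
    by_cases hp : p ∈ low P
    · simp [hp, transferFun_low _ _ hp]
    · simp [hp, transferFun_up _ _ hp]
  rw [h]
  have c1 := continuous_b₁ (P := P)
  have c2 := continuous_b₂ (P := P)
  have c3 := continuous_b₃ (P := P)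
  refine Continuous.if (fun p hp => ?_) (by fun_prop) (by fun_prop)
  change p ∈ frontier (low P) at hp
  simp [isClopen_low.frontier_eq] at hp

theorem abs_transferFun_le (φ ψ : C(Lam P, ℝ)) (p : Lam P) :
    |transferFun φ ψ p| ≤ 2 * Real.exp ‖φ‖ * ‖ψ‖ := by
  have key : ∀ q : Lam P, |Real.exp (φ q) * ψ q| ≤ Real.exp ‖φ‖ * ‖ψ‖ := by
    intro q
    rw [abs_mul, Real.abs_exp]
    have h1 : φ q ≤ ‖φ‖ := (le_abs_self _).trans (φ.norm_coe_le_norm q)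
    have h2 : |ψ q| ≤ ‖ψ‖ := ψ.norm_coe_le_norm q
    gcongr
  have hn : 0 ≤ Real.exp ‖φ‖ * ‖ψ‖ := by positivity
  by_cases hp : p ∈ low P
  · rw [transferFun_low _ _ hp]
    refine (abs_add_le _ _).trans ?_
    linarith [key (b₁ p), key (b₃ p)]
  · rw [transferFun_up _ _ hp]
    linarith [key (b₂ p)]

/-- The Ruelle–Perron–Frobenius operator `L_φ`, as a bounded operator on `C(Λ)`. -/
noncomputable def transferOp (φ : C(Lam P, ℝ)) : C(Lam P, ℝ) →L[ℝ] C(Lam P, ℝ) :=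
  LinearMap.mkContinuous
    { toFun := fun ψ => ⟨transferFun φ ψ, continuous_transferFun φ ψ⟩
      map_add' := fun ψ₁ ψ₂ => by
        ext p
        by_cases hp : p ∈ low P
        · simp [transferFun_low _ _ hp]
          ring
        · simp [transferFun_up _ _ hp]
          ring
      map_smul' := fun c ψ => by
        ext p
        by_cases hp : p ∈ low P
        · simp [transferFun_low _ _ hp]
          ring
        · simp [transferFun_up _ _ hp]
          ring }
    (2 * Real.exp ‖φ‖)
    (fun ψ => (ContinuousMap.norm_le _ (by positivity)).2 fun p => abs_transferFun_le φ ψ p)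

theorem transferOp_apply (φ ψ : C(Lam P, ℝ)) (x : Lam P) :
    transferOp φ ψ x = ∑ᶠ y ∈ G P ⁻¹' {x}, Real.exp (φ y) * ψ y := rfl

/-- The spectral radius of a bounded operator on a real Banach space,
`r(T) = limsup ‖T ^ n‖ ^ (1 / n)`. -/
noncomputable def spectralRad {E : Type*} [NormedAddCommGroup E] [NormedSpace ℝ E]
    (T : E →L[ℝ] E) : ℝ :=
  Filter.limsup (fun n : ℕ => ‖T ^ n‖ ^ (1 / (n : ℝ))) Filter.atTop

/-- `μ = L_φ^* η` for the dual of the transfer operator acting on (finite Borel) measures: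
`∫ ψ dμ = ∫ L_φ ψ dη` for every continuous `ψ`. -/
def IsDualTransfer (φ : C(Lam P, ℝ)) (η μ : MeasureTheory.Measure (Lam P)) : Prop :=
  ∀ ψ : C(Lam P, ℝ), ∫ x, ψ x ∂μ = ∫ x, transferOp φ ψ x ∂η

/-- Hölder continuity with some exponent in `(0, 1]`. -/
def IsHolder {X : Type*} [MetricSpace X] (u : X → ℝ) : Prop :=
  ∃ C r : NNReal, 0 < r ∧ r ≤ 1 ∧ HolderWith C r u

end HorseshoeProjection

/-! ### Sums over two weighted branches and their iterates -/

namespace HorseshoeProjection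

section BranchSum

variable {S : Type*}

/-! Inverse branches do not contract uniformly in the central direction: `f` fixes 0 and 1 and
expands by the factor e at 0. In the metric |dy| / (y (1 - y)), however, `f` is an isometry and the
affine branch contracts, with a loss of strictness only at y = 1 (`bfun_mul_cder`, `tfac_up_le`).
Compositions of n branches number about ω ^ n, yet a Lyapunov function shows that a high power of
the projective derivative, summed over all of them, grows at most like (5/4) ^ n
(`exists_tfac_moment`). The transfer operator grows at least at the rate ω exp (inf φ). Since 5/4 <
√ω, the bound on the oscillation of φ gives 5/4 exp (sup φ) < ω exp (inf φ), so the weighted moment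
decays exponentially relative to the operator. Hölder's inequality passes this to small powers r
(`exists_branchSum_tfac_rpow_le`), and `decaysOn_univ` returns to the Euclidean derivative, treating
separately the end points where the two metrics are not comparable.

The branches are Möbius in the central coordinate, so they multiply a distance by exactly the
geometric mean of the derivatives at its two ends. Cauchy–Schwarz then makes the r-th power of the
distance contract on average (`exists_branchSum_dist_le`). The distortion of the weights is thereby
bounded on average only, but by convexity of exp this is enough to compare two values of an iterate
(`iter_mul_exp_le`). Relative to their norms, the iterates of the Perron vector are therefore
uniformly Hölder, and they are bounded below because the transition graph of the planes is primitive
(`exists_iter_bounds`).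

Consequently the norms are almost multiplicative and comparable to λ ^ n (`exists_growth`). A
shift-invariant mean of the normalized iterates is the eigenfunction; the same mean of the
normalized images of ψ at a base point is a positive functional of ψ, which the Riesz theorem turns
into the eigenmeasure. -/

/-- The operator `F ↦ ∑ i, g i * F ∘ β i` of two weighted branches. -/
def branchSum (β : Bool → S → S) (g : Bool → S → ℝ) (F : S → ℝ) (s : S) : ℝ :=
  g true s * F (β true s) + g false s * F (β false s)

variable {β : Bool → S → S} {g g' : Bool → S → ℝ}

theorem branchSum_mono (hg : ∀ i s, 0 ≤ g i s) (hgg : ∀ i s, g i s ≤ g' i s) {F F' : S → ℝ}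
    (hF : ∀ s, 0 ≤ F s) (hFF : ∀ s, F s ≤ F' s) (s : S) :
    branchSum β g F s ≤ branchSum β g' F' s := by
  unfold branchSum
  have h : ∀ i, g i s * F (β i s) ≤ g' i s * F' (β i s) := fun i =>
    mul_le_mul (hgg i s) (hFF _) (hF _) ((hg i s).trans (hgg i s))
  exact add_le_add (h true) (h false)

theorem branchSum_nonneg (hg : ∀ i s, 0 ≤ g i s) {F : S → ℝ} (hF : ∀ s, 0 ≤ F s) (s : S) :
    0 ≤ branchSum β g F s :=
  add_nonneg (mul_nonneg (hg _ _) (hF _)) (mul_nonneg (hg _ _) (hF _))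

theorem branchSum_iterate_nonneg (hg : ∀ i s, 0 ≤ g i s) {F : S → ℝ} (hF : ∀ s, 0 ≤ F s)
    (n : ℕ) (s : S) : 0 ≤ (branchSum β g)^[n] F s := by
  induction n generalizing s with
  | zero => exact hF s
  | succ n ih =>
    rw [Function.iterate_succ_apply']
    exact branchSum_nonneg hg ih s

theorem branchSum_iterate_mono (hg : ∀ i s, 0 ≤ g i s) (hgg : ∀ i s, g i s ≤ g' i s)
    {F F' : S → ℝ} (hF : ∀ s, 0 ≤ F s) (hFF : ∀ s, F s ≤ F' s) (n : ℕ) (s : S) :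
    (branchSum β g)^[n] F s ≤ (branchSum β g')^[n] F' s := by
  induction n generalizing s with
  | zero => exact hFF s
  | succ n ih =>
    rw [Function.iterate_succ_apply', Function.iterate_succ_apply']
    exact branchSum_mono hg hgg (branchSum_iterate_nonneg hg hF n) ih s

theorem branchSum_const_mul (c : ℝ) (F : S → ℝ) :
    branchSum β g (fun s => c * F s) = fun s => c * branchSum β g F s := by
  funext s
  simp only [branchSum]
  ring

theorem branchSum_iterate_const_mul (c : ℝ) (F : S → ℝ) (n : ℕ) (s : S) :
    (branchSum β g)^[n] (fun s => c * F s) s = c * (branchSum β g)^[n] F s := by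
  induction n generalizing s with
  | zero => rfl
  | succ n ih =>
    simp only [Function.iterate_succ_apply', branchSum, ih]
    ring

theorem branchSum_iterate_weight_mul (c : ℝ) (F : S → ℝ) (n : ℕ) (s : S) :
    (branchSum β fun i s => c * g i s)^[n] F s = c ^ n * (branchSum β g)^[n] F s := by
  induction n generalizing s with
  | zero => simp
  | succ n ih =>
    simp only [Function.iterate_succ_apply', branchSum, ih]
    ring

theorem branchSum_iterate_add (F F' : S → ℝ) (n : ℕ) (s : S) :
    (branchSum β g)^[n] (fun s => F s + F' s) s
      = (branchSum β g)^[n] F s + (branchSum β g)^[n] F' s := by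
  induction n generalizing s with
  | zero => rfl
  | succ n ih =>
    simp only [Function.iterate_succ_apply', branchSum, ih]
    ring

/-- A multiplicative coboundary relation between two weights carries over to the iterates. -/
theorem mul_branchSum_iterate {w : S → ℝ} (hw : ∀ i s, w s * g i s = g' i s * w (β i s))
    (F : S → ℝ) (n : ℕ) (s : S) :
    w s * (branchSum β g)^[n] F s = (branchSum β g')^[n] (fun s => w s * F s) s := by
  induction n generalizing s with
  | zero => rfl
  | succ n ih =>
    simp only [Function.iterate_succ_apply', branchSum, ← ih]
    linear_combination (branchSum β g)^[n] F (β true s) * hw true s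
      + (branchSum β g)^[n] F (β false s) * hw false s

/-- Positivity of the weights lets a one-step Lyapunov inequality be iterated. -/
theorem branchSum_iterate_le_of_le (hg : ∀ i s, 0 ≤ g i s) {m : S → ℝ} (hm : ∀ s, 0 ≤ m s)
    {κ : ℝ} (hκ : 0 ≤ κ) (h : ∀ s, branchSum β g m s ≤ κ * m s) (n : ℕ) (s : S) :
    (branchSum β g)^[n] m s ≤ κ ^ n * m s := by
  induction n generalizing s with
  | zero => simp
  | succ n ih =>
    rw [Function.iterate_succ_apply']
    refine (branchSum_mono hg (fun _ _ => le_rfl) (branchSum_iterate_nonneg hg hm n) ih s).trans ?_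
    rw [branchSum_const_mul, pow_succ, mul_assoc]
    exact mul_le_mul_of_nonneg_left (h s) (pow_nonneg hκ n)

/-- Iterated sums along a semiconjugacy. -/
theorem branchSum_iterate_comp {S' : Type*} {β' : Bool → S' → S'} {k : Bool → S' → ℝ}
    {π : S → S'} (hπ : ∀ i s, π (β i s) = β' i (π s)) (F : S' → ℝ) (n : ℕ) (s : S) :
    (branchSum β fun i s => k i (π s))^[n] (fun s => F (π s)) s
      = (branchSum β' k)^[n] F (π s) := by
  induction n generalizing s with
  | zero => rfl
  | succ n ih => simp only [Function.iterate_succ_apply', branchSum, ih, hπ]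

/-- Hölder's inequality for two terms. -/
theorem rpow_mul_rpow_add_le {t : ℝ} (ht0 : 0 < t) (ht1 : t < 1) {a b c d : ℝ} (ha : 0 ≤ a)
    (hb : 0 ≤ b) (hc : 0 ≤ c) (hd : 0 ≤ d) :
    a ^ (1 - t) * b ^ t + c ^ (1 - t) * d ^ t ≤ (a + c) ^ (1 - t) * (b + d) ^ t := by
  have h1t : 0 < 1 - t := by linarith
  rcases eq_or_lt_of_le (add_nonneg ha hc) with hac | hac
  · have ha0 : a = 0 := by linarith
    have hc0 : c = 0 := by linarith
    simp [ha0, hc0, Real.zero_rpow h1t.ne']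
  rcases eq_or_lt_of_le (add_nonneg hb hd) with hbd | hbd
  · have hb0 : b = 0 := by linarith
    have hd0 : d = 0 := by linarith
    simp [hb0, hd0, Real.zero_rpow ht0.ne']
  -- Weighted AM–GM for each term after division by the sums; the resulting arithmetic means add up
  -- to 1.
  have key : ∀ x y : ℝ, 0 ≤ x → 0 ≤ y → x ^ (1 - t) * y ^ t
      ≤ ((1 - t) * (x / (a + c)) + t * (y / (b + d))) * ((a + c) ^ (1 - t) * (b + d) ^ t) := by
    intro x y hx hy
    have h := Real.geom_mean_le_arith_mean2_weighted h1t.le ht0.le (div_nonneg hx hac.le)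
      (div_nonneg hy hbd.le) (by ring)
    rw [Real.div_rpow hx hac.le, Real.div_rpow hy hbd.le, div_mul_div_comm,
      div_le_iff₀ (by positivity)] at h
    exact h
  refine (add_le_add (key a b ha hb) (key c d hc hd)).trans_eq ?_
  rw [← add_mul]
  have : (1 - t) * (a / (a + c)) + t * (b / (b + d)) + ((1 - t) * (c / (a + c)) + t * (d / (b + d)))
      = 1 := by
    field_simp
    ring
  rw [this, one_mul]

/-- Iterated sums are logarithmically convex in the weights. -/
theorem branchSum_iterate_rpow_le {t : ℝ} (ht0 : 0 < t) (ht1 : t < 1) (hg : ∀ i s, 0 ≤ g i s)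
    (hg' : ∀ i s, 0 ≤ g' i s) {F F' : S → ℝ} (hF : ∀ s, 0 ≤ F s) (hF' : ∀ s, 0 ≤ F' s)
    (n : ℕ) (s : S) :
    (branchSum β fun i s => g i s ^ (1 - t) * g' i s ^ t)^[n]
        (fun s => F s ^ (1 - t) * F' s ^ t) s
      ≤ ((branchSum β g)^[n] F s) ^ (1 - t) * ((branchSum β g')^[n] F' s) ^ t := by
  induction n generalizing s with
  | zero => exact le_rfl
  | succ n ih =>
    simp only [Function.iterate_succ_apply']
    have hn := branchSum_iterate_nonneg (β := β) hg hF n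
    have hn' := branchSum_iterate_nonneg (β := β) hg' hF' n
    -- The induction hypothesis is inserted under one more sum; what remains is the two-term Hölder
    -- inequality, one term per branch.
    refine (branchSum_mono (F' := fun s => ((branchSum β g)^[n] F s) ^ (1 - t)
        * ((branchSum β g')^[n] F' s) ^ t)
      (fun i s => mul_nonneg (Real.rpow_nonneg (hg i s) _) (Real.rpow_nonneg (hg' i s) _))
      (fun _ _ => le_rfl) (branchSum_iterate_nonneg
        (fun i s => mul_nonneg (Real.rpow_nonneg (hg i s) _) (Real.rpow_nonneg (hg' i s) _))
        (fun s => mul_nonneg (Real.rpow_nonneg (hF s) _) (Real.rpow_nonneg (hF' s) _)) n)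
      ih s).trans ?_
    have h := rpow_mul_rpow_add_le ht0 ht1 (mul_nonneg (hg true s) (hn (β true s)))
      (mul_nonneg (hg' true s) (hn' (β true s))) (mul_nonneg (hg false s) (hn (β false s)))
      (mul_nonneg (hg' false s) (hn' (β false s)))
    refine le_trans (le_of_eq ?_) h
    simp only [branchSum]
    rw [Real.mul_rpow (hg _ _) (hn _), Real.mul_rpow (hg _ _) (hn _),
      Real.mul_rpow (hg' _ _) (hn' _), Real.mul_rpow (hg' _ _) (hn' _)]
    ring

end BranchSum

end HorseshoeProjection

/-! ### The inverse branches -/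

namespace HorseshoeProjection

variable {P : Params}

open Classical in
/-- The inverse branches: `b₁` and `b₃` on the lower plane, twice `b₂` on the upper plane. -/
noncomputable def br (i : Bool) (p : Lam P) : Lam P :=
  if p ∈ low P then (if i then b₁ p else b₃ p) else b₂ p

open Classical in
/-- The indicator that discards the second copy of the branch `b₂`. -/
noncomputable def ind (i : Bool) (p : Lam P) : ℝ := if p ∈ low P ∨ i = true then 1 else 0

/-- The weights of the transfer operator. -/
noncomputable def wt (φ : C(Lam P, ℝ)) (i : Bool) (p : Lam P) : ℝ :=
  ind i p * Real.exp (φ (br i p))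

open Classical in
/-- The modulus of the derivative of the inverse branches in the central direction. -/
noncomputable def cder (p : Lam P) : ℝ :=
  if p ∈ low P then Real.exp 1 / (1 + (Real.exp 1 - 1) * p.1.2.1) ^ 2 else P.σ

open Classical in
/-- The modulus of the derivative of the inverse branches in the central direction, with respect
to the metric `|dy| / (y (1 - y))`. -/
noncomputable def tfac (p : Lam P) : ℝ :=
  if p ∈ low P then 1 else p.1.2.1 / (1 - P.σ * (1 - p.1.2.1))

/-- The density `y (1 - y)`. -/
def bfun (p : Lam P) : ℝ := p.1.2.1 * (1 - p.1.2.1)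

theorem one_lt_exp_one : 1 < Real.exp 1 := by simp

theorem exp_one_lt_three : Real.exp 1 < 3 := Real.exp_one_lt_d9.trans (by norm_num)

theorem one_sub_f {y : ℝ} (hy : y ∈ Set.Icc (0 : ℝ) 1) :
    1 - f y = (1 - y) / (1 + (Real.exp 1 - 1) * y) := by
  have h := den_f_pos hy
  rw [f_eq hy.1, eq_div_iff h.ne', sub_mul, div_mul_cancel₀ _ h.ne']
  ring

theorem le_f {y : ℝ} (hy : y ∈ Set.Icc (0 : ℝ) 1) : y ≤ f y := by
  have he := one_lt_exp_one
  rw [f_eq hy.1, le_div_iff₀ (den_f_pos hy)]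
  nlinarith [mul_nonneg (mul_nonneg hy.1 (sub_nonneg.2 hy.2)) (sub_nonneg.2 he.le)]

theorem br_low (i : Bool) {p : Lam P} (hp : p ∈ low P) : br i p = if i then b₁ p else b₃ p := by
  simp [br, hp]

theorem br_up (i : Bool) {p : Lam P} (hp : p ∉ low P) : br i p = b₂ p := by
  simp [br, hp]

theorem br_y_low (i : Bool) {p : Lam P} (hp : p ∈ low P) : (br i p).1.2.1 = f p.1.2.1 := by
  cases i <;> simp [br_low _ hp, b₁_val hp, b₃_val hp]

theorem br_y_up (i : Bool) {p : Lam P} (hp : p ∉ low P) :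
    (br i p).1.2.1 = P.σ * (1 - p.1.2.1) := by
  simp [br_up _ hp, b₂_val hp]

theorem br_x_low (i : Bool) {p : Lam P} (hp : p ∈ low P) : (br i p).1.1 = P.ρ * p.1.1 := by
  cases i <;> simp [br_low _ hp, b₁_val hp, b₃_val hp]

theorem br_x_up (i : Bool) {p : Lam P} (hp : p ∉ low P) :
    (br i p).1.1 = 3 / 4 - P.ρ * p.1.1 := by
  simp [br_up _ hp, b₂_val hp]

theorem br_true_mem_low (p : Lam P) : br true p ∈ low P := by
  by_cases hp : p ∈ low P
  · simp [br_low _ hp, low, b₁_val hp]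
  · simp [br_up _ hp, low, b₂_val hp]

theorem br_false_mem_low {p : Lam P} : br false p ∈ low P ↔ p ∉ low P := by
  by_cases hp : p ∈ low P
  · have : br false p ∉ low P := by simp [br_low _ hp, low, b₃_val hp]
    simp [hp, this]
  · have : br false p ∈ low P := by simp [br_up _ hp, low, b₂_val hp]
    simp [hp, this]

theorem ind_low (i : Bool) {p : Lam P} (hp : p ∈ low P) : ind i p = 1 := by simp [ind, hp]

theorem ind_true (p : Lam P) : ind true p = 1 := by simp [ind]

theorem ind_false_up {p : Lam P} (hp : p ∉ low P) : ind false p = 0 := by simp [ind, hp]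

theorem ind_nonneg (i : Bool) (p : Lam P) : 0 ≤ ind i p := by
  unfold ind
  split_ifs <;> norm_num

theorem ind_congr (i : Bool) {p q : Lam P} (h : p ∈ low P ↔ q ∈ low P) : ind i p = ind i q := by
  by_cases hp : p ∈ low P
  · rw [ind_low i hp, ind_low i (h.1 hp)]
  · simp [ind, hp, mt h.2 hp]

theorem wt_nonneg (φ : C(Lam P, ℝ)) (i : Bool) (p : Lam P) : 0 ≤ wt φ i p :=
  mul_nonneg (ind_nonneg i p) (Real.exp_pos _).le

theorem transferOp_eq_branchSum (φ ψ : C(Lam P, ℝ)) (p : Lam P) :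
    transferOp φ ψ p = branchSum br (wt φ) ψ p := by
  change transferFun φ ψ p = _
  by_cases hp : p ∈ low P
  · simp [transferFun_low _ _ hp, branchSum, wt, ind_low _ hp, br_low _ hp]
  · simp [transferFun_up _ _ hp, branchSum, wt, ind_true, ind_false_up hp, br_up _ hp]

theorem cder_nonneg (p : Lam P) : 0 ≤ cder p := by
  unfold cder
  split_ifs
  · positivity
  · exact P.σ_pos.le

theorem cder_up {p : Lam P} (hp : p ∉ low P) : cder p ≤ 1 := by
  simp only [cder, hp, if_false]
  linarith [P.σ_lt]

theorem cder_le (p : Lam P) : cder p ≤ Real.exp 1 := by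
  have he := one_lt_exp_one
  by_cases hp : p ∈ low P
  · simp only [cder, hp, if_true]
    have hy := y_mem p
    refine div_le_self (Real.exp_pos 1).le (one_le_pow₀ ?_)
    nlinarith [hy.1]
  · exact (cder_up hp).trans he.le

theorem den_tfac_pos (p : Lam P) : 0 < 1 - P.σ * (1 - p.1.2.1) := by
  have hy := y_mem p
  nlinarith [P.σ_pos, P.σ_lt, hy.1]

theorem tfac_nonneg (p : Lam P) : 0 ≤ tfac p := by
  unfold tfac
  split_ifs
  · exact zero_le_one
  · exact div_nonneg (y_mem p).1 (den_tfac_pos p).le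

/-- Here 1 - `tfac` = (1 - σ)(1 - y) / (1 - σ(1 - y)); the denominator is at most 1 and 1 - σ
exceeds 1/2. Contraction degenerates only at y = 1. -/
theorem tfac_up_le {p : Lam P} (hp : p ∉ low P) : tfac p ≤ 1 - (1 - p.1.2.1) / 2 := by
  simp only [tfac, hp, if_false]
  rw [div_le_iff₀ (den_tfac_pos p)]
  have hy := y_mem p
  nlinarith [mul_nonneg (sub_nonneg.2 hy.2) (sub_nonneg.2 P.σ_lt.le), P.σ_pos,
    mul_nonneg (sub_nonneg.2 hy.2) P.σ_pos.le,
    mul_nonneg (mul_nonneg (sub_nonneg.2 hy.2) P.σ_pos.le) (sub_nonneg.2 hy.2)]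

theorem bfun_nonneg (p : Lam P) : 0 ≤ bfun p :=
  mul_nonneg (y_mem p).1 (sub_nonneg.2 (y_mem p).2)

theorem bfun_le_one (p : Lam P) : bfun p ≤ 1 := by
  unfold bfun
  nlinarith [sq_nonneg (p.1.2.1 - 1 / 2)]

/-- The chain rule for the metric |dy| / (y (1 - y)). The factor is 1 on the lower plane because `f`
is the time-one map of the flow of y' = y (1 - y). -/
theorem bfun_mul_cder (i : Bool) (p : Lam P) :
    bfun p * cder p = tfac p * bfun (br i p) := by
  have hy := y_mem p
  unfold bfun
  by_cases hp : p ∈ low P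
  · have h := den_f_pos hy
    rw [br_y_low i hp, one_sub_f hy, f_eq hy.1]
    simp only [cder, tfac, hp, if_true]
    field_simp
  · rw [br_y_up i hp]
    simp only [cder, tfac, hp, if_false]
    have h := (den_tfac_pos p).ne'
    rw [div_mul_eq_mul_div, eq_div_iff h]
    ring

/-- Möbius maps satisfy |g a - g b|² = |g' a| |g' b| |a - b|². Having an equality rather than a mean
value estimate permits exact telescoping along compositions of branches. -/
theorem abs_y_br_sub (i : Bool) {p q : Lam P} (h : p ∈ low P ↔ q ∈ low P) :
    |(br i p).1.2.1 - (br i q).1.2.1|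
      = Real.sqrt (cder p) * Real.sqrt (cder q) * |p.1.2.1 - q.1.2.1| := by
  by_cases hp : p ∈ low P
  · have hq := h.1 hp
    have h1 := den_f_pos (y_mem p)
    have h2 := den_f_pos (y_mem q)
    rw [br_y_low i hp, br_y_low i hq, f_eq (y_mem p).1, f_eq (y_mem q).1,
      ← Real.sqrt_mul (cder_nonneg p)]
    simp only [cder, hp, hq, if_true]
    have e1 : Real.exp 1 / (1 + (Real.exp 1 - 1) * p.1.2.1) ^ 2
        * (Real.exp 1 / (1 + (Real.exp 1 - 1) * q.1.2.1) ^ 2)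
        = (Real.exp 1 / ((1 + (Real.exp 1 - 1) * p.1.2.1)
          * (1 + (Real.exp 1 - 1) * q.1.2.1))) ^ 2 := by
      field_simp
    rw [e1, Real.sqrt_sq (by positivity)]
    rw [← abs_of_nonneg (show 0 ≤ Real.exp 1 / ((1 + (Real.exp 1 - 1) * p.1.2.1)
          * (1 + (Real.exp 1 - 1) * q.1.2.1)) by positivity), ← abs_mul]
    congr 1
    rw [div_sub_div _ _ h1.ne' h2.ne', div_mul_eq_mul_div]
    congr 1
    ring
  · have hq : q ∉ low P := fun hq => hp (h.2 hq)
    rw [br_y_up i hp, br_y_up i hq, ← Real.sqrt_mul (cder_nonneg p)]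
    simp only [cder, hp, hq, if_false]
    rw [Real.sqrt_mul_self P.σ_pos.le, ← abs_of_pos P.σ_pos, ← abs_mul, ← abs_neg,
      abs_of_pos P.σ_pos]
    congr 1
    ring

theorem abs_x_br_sub (i : Bool) {p q : Lam P} (h : p ∈ low P ↔ q ∈ low P) :
    |(br i p).1.1 - (br i q).1.1| = P.ρ * |p.1.1 - q.1.1| := by
  by_cases hp : p ∈ low P
  · rw [br_x_low i hp, br_x_low i (h.1 hp), ← mul_sub, abs_mul, abs_of_pos P.ρ_pos]
  · rw [br_x_up i hp, br_x_up i fun hq => hp (h.2 hq)]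
    rw [show 3 / 4 - P.ρ * p.1.1 - (3 / 4 - P.ρ * q.1.1) = -(P.ρ * (p.1.1 - q.1.1)) by ring,
      abs_neg, abs_mul, abs_of_pos P.ρ_pos]

theorem dist_le_one (p q : Lam P) : dist p q ≤ 1 := by
  rw [Subtype.dist_eq, Prod.dist_eq, Prod.dist_eq, Real.dist_eq, Real.dist_eq, Real.dist_eq]
  have h1 := x_mem p
  have h2 := x_mem q
  have h3 := y_mem p
  have h4 := y_mem q
  refine max_le (abs_le.2 ⟨by linarith [h1.1, h2.2], by linarith [h1.2, h2.1]⟩)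
    (max_le (abs_le.2 ⟨by linarith [h3.1, h4.2], by linarith [h3.2, h4.1]⟩) ?_)
  rcases z_cases p with h | h <;> rcases z_cases q with h' | h' <;> rw [h, h'] <;>
    norm_num [abs_le]

theorem dist_of_not_iff {p q : Lam P} (h : ¬(p ∈ low P ↔ q ∈ low P)) : 5 / 6 ≤ dist p q := by
  rw [Subtype.dist_eq, Prod.dist_eq, Prod.dist_eq]
  refine le_max_of_le_right (le_max_of_le_right ?_)
  rw [Real.dist_eq]
  change ¬(p.1.2.2 = 0 ↔ q.1.2.2 = 0) at h
  rcases z_cases p with h1 | h1 <;> rcases z_cases q with h2 | h2 <;> rw [h1, h2] at h ⊢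
  · exact absurd Iff.rfl h
  · norm_num
  · norm_num
  · exact absurd Iff.rfl h

theorem dist_eq_max {p q : Lam P} (h : p ∈ low P ↔ q ∈ low P) :
    dist p q = max |p.1.1 - q.1.1| |p.1.2.1 - q.1.2.1| := by
  have hz : dist p.1.2.2 q.1.2.2 = 0 := by
    change p.1.2.2 = 0 ↔ q.1.2.2 = 0 at h
    rw [dist_eq_zero]
    rcases z_cases p with h1 | h1 <;> rcases z_cases q with h2 | h2 <;> rw [h1, h2] at h ⊢ <;>
      norm_num at h
  rw [Subtype.dist_eq, Prod.dist_eq, Prod.dist_eq, hz, Real.dist_eq, Real.dist_eq]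
  rw [max_eq_left (a := |p.1.2.1 - q.1.2.1|) (abs_nonneg _)]

/-! ### Growth of the projective derivative along the branches -/

/-- The bound 1.23 leaves room for two errors of 1/100 below 5/4. -/
theorem exp_fifth_lt : Real.exp (1 / 5) < 123 / 100 := by
  have h : Real.exp (1 / 5) ^ 5 = Real.exp 1 := by
    rw [← Real.exp_nat_mul]
    norm_num
  refine lt_of_pow_lt_pow_left₀ 5 (by norm_num) ?_
  rw [h]
  exact Real.exp_one_lt_d9.trans (by norm_num)

/-- The Lyapunov function on the lower plane. -/
noncomputable def lyap (y : ℝ) : ℝ := max (1 - y) ((1 / 5) ^ 5) ^ (-(1 / 5 : ℝ))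

theorem lyap_arg_pos (y : ℝ) : 0 < max (1 - y) ((1 / 5 : ℝ) ^ 5) :=
  lt_max_of_lt_right (by norm_num)

theorem fifth_rpow : ((1 / 5 : ℝ) ^ 5) ^ (-(1 / 5 : ℝ)) = 5 := by
  rw [← Real.rpow_natCast, ← Real.rpow_mul (by norm_num)]
  norm_num

theorem lyap_le_five (y : ℝ) : lyap y ≤ 5 := by
  rw [← fifth_rpow]
  exact Real.rpow_le_rpow_of_nonpos (by norm_num) (le_max_right _ _) (by norm_num)

theorem one_le_lyap {y : ℝ} (hy : y ∈ Set.Icc (0 : ℝ) 1) : 1 ≤ lyap y :=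
  Real.one_le_rpow_of_pos_of_le_one_of_nonpos (lyap_arg_pos y)
    (max_le (by linarith [hy.1]) (by norm_num)) (by norm_num)

/-- Here 1 - y ≥ 2/3 > (4/5)^5. The factor 5/4 cancels the 4/5 in the Lyapunov function on the upper
plane. -/
theorem lyap_le_of_le {y : ℝ} (hy : y ≤ 1 / 3) : lyap y ≤ 5 / 4 := by
  have h : ((4 / 5 : ℝ) ^ 5) ^ (-(1 / 5 : ℝ)) = 5 / 4 := by
    rw [← Real.rpow_natCast, ← Real.rpow_mul (by norm_num)]
    norm_num
  rw [← h]
  refine Real.rpow_le_rpow_of_nonpos (by norm_num) (le_max_of_le_left ?_) (by norm_num)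
  norm_num
  linarith

/-- The quotient (1 - f y) / (1 - y) is 1 / (1 + (e - 1) y), smallest at y = 1. -/
theorem one_sub_f_ge {y : ℝ} (hy : y ∈ Set.Icc (0 : ℝ) 1) :
    Real.exp (-1) * (1 - y) ≤ 1 - f y := by
  have he := one_lt_exp_one
  rw [one_sub_f hy, le_div_iff₀ (den_f_pos hy), Real.exp_neg]
  have h1 : 1 + (Real.exp 1 - 1) * y ≤ Real.exp 1 := by nlinarith [hy.2]
  have h2 : (Real.exp 1)⁻¹ * (1 - y) * (1 + (Real.exp 1 - 1) * y)
      ≤ (Real.exp 1)⁻¹ * (1 - y) * Real.exp 1 :=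
    mul_le_mul_of_nonneg_left h1 (mul_nonneg (by positivity) (by linarith [hy.2]))
  refine h2.trans_eq ?_
  field_simp

/-- One step shrinks 1 - y by at most the factor e, which the exponent -1/5 turns into e^(1/5);
truncation does not spoil the estimate. -/
theorem lyap_f_le {y : ℝ} (hy : y ∈ Set.Icc (0 : ℝ) 1) :
    lyap (f y) ≤ 123 / 100 * lyap y := by
  have h1 : Real.exp (-1) * max (1 - y) ((1 / 5 : ℝ) ^ 5) ≤ max (1 - f y) ((1 / 5 : ℝ) ^ 5) := by
    rw [mul_max_of_nonneg _ _ (Real.exp_pos _).le]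
    refine max_le_max (one_sub_f_ge hy) (mul_le_of_le_one_left (by norm_num) ?_)
    simp
  have h2 := Real.rpow_le_rpow_of_nonpos (mul_pos (Real.exp_pos _) (lyap_arg_pos y)) h1
    (show -(1 / 5 : ℝ) ≤ 0 by norm_num)
  rw [Real.mul_rpow (Real.exp_pos _).le (lyap_arg_pos y).le, ← Real.exp_mul] at h2
  refine h2.trans (mul_le_mul_of_nonneg_right ?_ (Real.rpow_nonneg (lyap_arg_pos y).le _))
  rw [show -1 * -(1 / 5 : ℝ) = 1 / 5 by norm_num]
  exact exp_fifth_lt.le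

/-- High moments of the projective derivative grow slower than `(5 / 4) ^ n`, uniformly. -/
theorem exists_tfac_moment (P : Params) : ∃ α : ℕ, 1 < α ∧ ∃ C : ℝ, 0 < C ∧ ∀ (n : ℕ) (p : Lam P),
    (branchSum br fun i p => ind i p * tfac p ^ α)^[n] (fun _ => 1) p ≤ C * (5 / 4) ^ n := by
  classical
  -- The base bounds `tfac` at the image under the branch to the upper plane, once 1 - y > (1/5)^5;
  -- the power α makes it negligible there.
  obtain ⟨α₀, hα₀⟩ := exists_pow_lt_of_lt_one (show (0 : ℝ) < 1 / 100 by norm_num)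
    (show (1 - (1 / 5) ^ 5 / 6 : ℝ) < 1 by norm_num)
  set α := α₀ + 2 with hαdef
  have hα : (1 - (1 / 5) ^ 5 / 6 : ℝ) ^ α < 1 / 100 :=
    (pow_le_pow_of_le_one (by norm_num) (by norm_num) (by omega)).trans_lt hα₀
  -- On the upper plane m is 4/5 of its own one-step sum, so the factor 5/4 is automatic. The added
  -- 1/100 keeps m bounded below where `tfac` vanishes, at y = 0.
  let m : Lam P → ℝ := fun p => if p ∈ low P then lyap p.1.2.1 else
    4 / 5 * (tfac p ^ α * lyap (P.σ * (1 - p.1.2.1))) + 1 / 100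
  have hg : ∀ i (p : Lam P), 0 ≤ ind i p * tfac p ^ α := fun i p =>
    mul_nonneg (ind_nonneg i p) (pow_nonneg (tfac_nonneg p) _)
  have hτ : ∀ p : Lam P, P.σ * (1 - p.1.2.1) ∈ Set.Icc (0 : ℝ) (1 / 3) := by
    intro p
    have hy := y_mem p
    exact ⟨mul_nonneg P.σ_pos.le (by linarith [hy.2]), by nlinarith [P.σ_pos, P.σ_lt, hy.1, hy.2]⟩
  have hτ0 : ∀ p : Lam P, 0 ≤ tfac p ^ α * lyap (P.σ * (1 - p.1.2.1)) := fun p =>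
    mul_nonneg (pow_nonneg (tfac_nonneg p) _) (Real.rpow_nonneg (lyap_arg_pos _).le _)
  have hm_low : ∀ p ∈ low P, m p = lyap p.1.2.1 := fun p hp => by simp only [m, hp, if_true]
  have hm_up : ∀ p ∉ low P,
      m p = 4 / 5 * (tfac p ^ α * lyap (P.σ * (1 - p.1.2.1))) + 1 / 100 := fun p hp => by
    simp only [m, hp, if_false]
  have hm_up_le : ∀ p ∉ low P, m p ≤ tfac p ^ α + 1 / 100 := fun p hp => by
    rw [hm_up p hp]
    have h1 := mul_le_mul_of_nonneg_left (lyap_le_of_le (hτ p).2) (pow_nonneg (tfac_nonneg p) α)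
    linarith
  have htf : ∀ p : Lam P, p ∉ low P → tfac p ≤ 1 := fun p hp =>
    (tfac_up_le hp).trans (by linarith [(y_mem p).2])
  have hm_ge : ∀ p, 1 / 100 ≤ m p := by
    intro p
    by_cases hp : p ∈ low P
    · rw [hm_low p hp]
      linarith [one_le_lyap (y_mem p)]
    · rw [hm_up p hp]
      linarith [hτ0 p]
  have hm_le : ∀ p, m p ≤ 5 := by
    intro p
    by_cases hp : p ∈ low P
    · rw [hm_low p hp]
      exact lyap_le_five _
    · linarith [hm_up_le p hp, pow_le_one₀ (n := α) (tfac_nonneg p) (htf p hp)]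
  have hsup : ∀ p, branchSum br (fun i p => ind i p * tfac p ^ α) m p ≤ 5 / 4 * m p := by
    intro p
    have hy := y_mem p
    by_cases hp : p ∈ low P
    · have hf : br false p ∉ low P := fun h => br_false_mem_low.1 h hp
      have ht : tfac p = 1 := by simp [tfac, hp]
      simp only [branchSum, ind_low _ hp, ht, one_pow, one_mul]
      rw [hm_low _ (br_true_mem_low p), hm_low p hp, br_y_low _ hp]
      have hup := hm_up_le _ hf
      -- Close to y = 1 the upper branch may contribute almost 1, but `lyap` has its maximal value 5
      -- and 5 + 1 + 1/100 ≤ (5/4) · 5.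
      by_cases hcase : 1 - p.1.2.1 ≤ (1 / 5 : ℝ) ^ 5
      · have e1 : lyap p.1.2.1 = 5 := by rw [lyap, max_eq_right hcase, fifth_rpow]
        rw [e1]
        linarith [lyap_le_five (f p.1.2.1),
          pow_le_one₀ (n := α) (tfac_nonneg _) (htf _ hf)]
      · have h3 : tfac (br false p) ≤ 1 - (1 / 5) ^ 5 / 6 := by
          refine (tfac_up_le hf).trans ?_
          rw [br_y_low _ hp]
          have h4 := one_sub_f_ge hy
          have h5 : (1 / 3 : ℝ) ≤ Real.exp (-1) := by
            rw [Real.exp_neg, one_div]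
            exact inv_anti₀ (Real.exp_pos 1) exp_one_lt_three.le
          push Not at hcase
          nlinarith
        have h6 : tfac (br false p) ^ α < 1 / 100 :=
          (pow_le_pow_left₀ (tfac_nonneg _) h3 α).trans_lt hα
        linarith [lyap_f_le hy, one_le_lyap hy]
    · simp only [branchSum, ind_true, ind_false_up hp, zero_mul, add_zero, one_mul]
      rw [hm_low _ (br_true_mem_low p), hm_up p hp, br_y_up _ hp]
      linarith
  -- 500 = 100 · 5, from 1 ≤ 100 m and m ≤ 5.
  refine ⟨α, by omega, 500, by norm_num, fun n p => ?_⟩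
  have h1 : (branchSum br fun i p => ind i p * tfac p ^ α)^[n] (fun _ => 1) p
      ≤ (branchSum br fun i p => ind i p * tfac p ^ α)^[n] (fun p => 100 * m p) p :=
    branchSum_iterate_mono hg (fun _ _ => le_rfl) (fun _ => zero_le_one)
      (fun p => by linarith [hm_ge p]) n p
  rw [branchSum_iterate_const_mul] at h1
  have h2 := branchSum_iterate_le_of_le hg (fun p => by linarith [hm_ge p]) (by norm_num) hsup n p
  have h3 : (5 / 4 : ℝ) ^ n * m p ≤ (5 / 4) ^ n * 5 :=
    mul_le_mul_of_nonneg_left (hm_le p) (by positivity)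
  linarith

end HorseshoeProjection

/-! ### Uniform estimates for the iterates of the transfer operator -/

namespace HorseshoeProjection

open Real (goldenRatio)

variable {P : Params}

/-- Pairs of points of `Λ` that lie in the same horizontal plane. -/
abbrev SamePlane (P : Params) : Type := {s : Lam P × Lam P // s.1 ∈ low P ↔ s.2 ∈ low P}

theorem br_mem_low_iff (i : Bool) {p q : Lam P} (h : p ∈ low P ↔ q ∈ low P) :
    br i p ∈ low P ↔ br i q ∈ low P := by
  cases i
  · rw [br_false_mem_low, br_false_mem_low, h]
  · simp [br_true_mem_low]

/-- The inverse branches on pairs. -/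
noncomputable def brPair (i : Bool) (s : SamePlane P) : SamePlane P :=
  ⟨(br i s.1.1, br i s.1.2), br_mem_low_iff i s.2⟩

/-- A Perron eigenvector of the transition graph of the two planes. -/
noncomputable def perron (P : Params) : C(Lam P, ℝ) where
  toFun := (low P).indicator (fun _ => goldenRatio - 1) + 1
  continuous_toFun := (continuous_const.indicator (by simp [isClopen_low.frontier_eq])).add
    continuous_one

theorem perron_low {p : Lam P} (hp : p ∈ low P) : perron P p = goldenRatio := by
  simp [perron, hp]

theorem perron_up {p : Lam P} (hp : p ∉ low P) : perron P p = 1 := by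
  simp [perron, hp]

theorem one_le_perron (p : Lam P) : 1 ≤ perron P p := by
  by_cases hp : p ∈ low P
  · rw [perron_low hp]
    exact Real.one_lt_goldenRatio.le
  · rw [perron_up hp]

theorem perron_le (p : Lam P) : perron P p ≤ goldenRatio := by
  by_cases hp : p ∈ low P
  · rw [perron_low hp]
  · rw [perron_up hp]
    exact Real.one_lt_goldenRatio.le

/-- The iterates of the transfer operator on the Perron vector. -/
noncomputable def iter (φ : C(Lam P, ℝ)) (n : ℕ) : C(Lam P, ℝ) := (transferOp φ ^ n) (perron P)

theorem iter_zero (φ : C(Lam P, ℝ)) : iter φ 0 = perron P := rfl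

theorem iter_succ (φ : C(Lam P, ℝ)) (n : ℕ) : iter φ (n + 1) = transferOp φ (iter φ n) := by
  simp [iter, pow_succ']

theorem iter_succ_apply (φ : C(Lam P, ℝ)) (n : ℕ) (p : Lam P) :
    iter φ (n + 1) p = branchSum br (wt φ) (iter φ n) p := by
  rw [iter_succ, transferOp_eq_branchSum]

theorem exp_le_exp_iSup (φ : C(Lam P, ℝ)) (p : Lam P) :
    Real.exp (φ p) ≤ Real.exp (⨆ x, φ x) :=
  Real.exp_le_exp.2 (le_ciSup (isCompact_range φ.continuous).bddAbove p)

theorem exp_iInf_le_exp (φ : C(Lam P, ℝ)) (p : Lam P) :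
    Real.exp (⨅ x, φ x) ≤ Real.exp (φ p) :=
  Real.exp_le_exp.2 (ciInf_le (isCompact_range φ.continuous).bddBelow p)

theorem wt_le (φ : C(Lam P, ℝ)) (i : Bool) (p : Lam P) :
    wt φ i p ≤ Real.exp (⨆ x, φ x) * ind i p := by
  rw [mul_comm]
  exact mul_le_mul_of_nonneg_left (exp_le_exp_iSup φ _) (ind_nonneg i p)

theorem wt_le' (φ : C(Lam P, ℝ)) (i : Bool) (p : Lam P) : wt φ i p ≤ Real.exp (⨆ x, φ x) := by
  refine (wt_le φ i p).trans (mul_le_of_le_one_right (Real.exp_pos _).le ?_)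
  unfold ind
  split_ifs <;> norm_num

/-! ### Lower and upper growth of the iterates -/

/-- The exponential growth rate of the number of branches, times the least weight. -/
noncomputable def lowerRate (φ : C(Lam P, ℝ)) : ℝ := goldenRatio * Real.exp (⨅ x, φ x)

theorem lowerRate_pos (φ : C(Lam P, ℝ)) : 0 < lowerRate φ :=
  mul_pos Real.goldenRatio_pos (Real.exp_pos _)

theorem branchSum_wt_low (φ : C(Lam P, ℝ)) (F : Lam P → ℝ) {p : Lam P} (hp : p ∈ low P) :
    branchSum br (wt φ) F p = Real.exp (φ (br true p)) * F (br true p)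
      + Real.exp (φ (br false p)) * F (br false p) := by
  simp [branchSum, wt, ind_low _ hp]

theorem branchSum_wt_up (φ : C(Lam P, ℝ)) (F : Lam P → ℝ) {p : Lam P} (hp : p ∉ low P) :
    branchSum br (wt φ) F p = Real.exp (φ (br true p)) * F (br true p) := by
  simp [branchSum, wt, ind_true, ind_false_up hp]

/-- With every weight replaced by exp (inf φ) this is the eigenvector equation of the transition
graph, that is, ω² = ω + 1 on the lower plane. -/
theorem lowerRate_mul_perron_le (φ : C(Lam P, ℝ)) (p : Lam P) :
    lowerRate φ * perron P p ≤ iter φ 1 p := by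
  have hω := Real.goldenRatio_pos
  have h1 := exp_iInf_le_exp φ (br true p)
  have h2 := exp_iInf_le_exp φ (br false p)
  rw [iter_succ_apply, iter_zero]
  unfold lowerRate
  by_cases hp : p ∈ low P
  · rw [branchSum_wt_low φ _ hp, perron_low hp, perron_low (br_true_mem_low p),
      perron_up fun h => br_false_mem_low.1 h hp]
    have h3 := Real.goldenRatio_sq
    calc goldenRatio * Real.exp (⨅ x, φ x) * goldenRatio
        = Real.exp (⨅ x, φ x) * goldenRatio + Real.exp (⨅ x, φ x) * 1 := by
          linear_combination Real.exp (⨅ x, φ x) * h3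
      _ ≤ _ := by gcongr
  · rw [branchSum_wt_up φ _ hp, perron_up hp, perron_low (br_true_mem_low p)]
    nlinarith

/-- The two claims are proved together because propagating the inequality through the operator
requires nonnegative functions. -/
theorem iter_pos_and_le (φ : C(Lam P, ℝ)) (n : ℕ) :
    ∀ p, 0 < iter φ n p ∧ lowerRate φ * iter φ n p ≤ iter φ (n + 1) p := by
  induction n with
  | zero =>
    intro p
    exact ⟨zero_lt_one.trans_le (one_le_perron p), lowerRate_mul_perron_le φ p⟩
  | succ n ih =>
    intro p
    refine ⟨(mul_pos (lowerRate_pos φ) (ih p).1).trans_le (ih p).2, ?_⟩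
    rw [iter_succ_apply φ n, iter_succ_apply φ (n + 1)]
    have h := branchSum_mono (β := br) (wt_nonneg φ) (fun _ _ => le_rfl)
      (fun p => (mul_pos (lowerRate_pos φ) (ih p).1).le) (fun p => (ih p).2) p
    rwa [branchSum_const_mul] at h

theorem iter_pos (φ : C(Lam P, ℝ)) (n : ℕ) (p : Lam P) : 0 < iter φ n p :=
  (iter_pos_and_le φ n p).1

theorem iter_le_norm (φ : C(Lam P, ℝ)) (n : ℕ) (p : Lam P) : iter φ n p ≤ ‖iter φ n‖ :=
  (le_abs_self _).trans ((iter φ n).norm_coe_le_norm p)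

theorem lowerRate_mul_norm_le (φ : C(Lam P, ℝ)) (n : ℕ) :
    lowerRate φ * ‖iter φ n‖ ≤ ‖iter φ (n + 1)‖ := by
  have h0 := lowerRate_pos φ
  rw [← le_div_iff₀' h0]
  refine (ContinuousMap.norm_le _ (by positivity)).2 fun p => ?_
  rw [Real.norm_of_nonneg (iter_pos φ n p).le, le_div_iff₀' h0]
  exact ((iter_pos_and_le φ n p).2).trans (iter_le_norm φ _ p)

theorem lowerRate_pow_mul_norm_le (φ : C(Lam P, ℝ)) (j m : ℕ) :
    lowerRate φ ^ j * ‖iter φ m‖ ≤ ‖iter φ (j + m)‖ := by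
  induction j with
  | zero => simp
  | succ j ih =>
    rw [pow_succ', mul_assoc, show j + 1 + m = j + m + 1 by ring]
    exact (mul_le_mul_of_nonneg_left ih (lowerRate_pos φ).le).trans (lowerRate_mul_norm_le φ _)

theorem norm_iter_succ_le (φ : C(Lam P, ℝ)) (n : ℕ) :
    ‖iter φ (n + 1)‖ ≤ 2 * Real.exp (⨆ x, φ x) * ‖iter φ n‖ := by
  refine (ContinuousMap.norm_le _ (by positivity)).2 fun p => ?_
  rw [Real.norm_of_nonneg (iter_pos φ _ p).le, iter_succ_apply, branchSum]
  have h : ∀ i, wt φ i p * iter φ n (br i p) ≤ Real.exp (⨆ x, φ x) * ‖iter φ n‖ := fun i =>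
    mul_le_mul (wt_le' φ i p) (iter_le_norm φ n _) (iter_pos φ n _).le (Real.exp_pos _).le
  linarith [h true, h false]

theorem branchSum_pair_iterate_iter (φ : C(Lam P, ℝ)) (j m : ℕ) (s : SamePlane P) :
    (branchSum brPair fun i s => wt φ i s.1.1)^[j] (fun s => iter φ m s.1.1) s
      = iter φ (j + m) s.1.1 := by
  induction j generalizing s with
  | zero => simp
  | succ j ih =>
    rw [Function.iterate_succ_apply', show j + 1 + m = j + m + 1 by ring, iter_succ_apply]
    simp only [branchSum, ih, brPair]

/-! ### Decay of the projective derivative on average -/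

/-- Bounding the weights by exp (sup φ) leaves the pure moment of `exists_tfac_moment` at the second
point; `lowerRate_pow_mul_norm_le` converts the norm of the m-th iterate into that of the (j +
m)-th. -/
theorem exists_branchSum_tfac_pow_le (φ : C(Lam P, ℝ)) :
    ∃ α : ℕ, 1 < α ∧ ∃ C : ℝ, 0 < C ∧ ∀ (j m : ℕ) (s : SamePlane P),
      (branchSum brPair fun i s => wt φ i s.1.1 * tfac s.1.2 ^ α)^[j]
        (fun s => iter φ m s.1.1) s
        ≤ C * (5 / 4 * Real.exp (⨆ x, φ x) / lowerRate φ) ^ j * ‖iter φ (j + m)‖ := by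
  obtain ⟨α, hα, C, hC, h⟩ := exists_tfac_moment P
  refine ⟨α, hα, C, hC, fun j m s => ?_⟩
  have hwt : ∀ i (s : SamePlane P), 0 ≤ wt φ i s.1.1 * tfac s.1.2 ^ α := fun i s =>
    mul_nonneg (wt_nonneg φ i _) (pow_nonneg (tfac_nonneg _) _)
  have h1 := branchSum_iterate_mono (β := brPair) hwt
    (g' := fun i s => Real.exp (⨆ x, φ x) * (ind i s.1.2 * tfac s.1.2 ^ α))
    (fun i s => by
      rw [← mul_assoc]
      refine mul_le_mul_of_nonneg_right ?_ (pow_nonneg (tfac_nonneg _) _)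
      rw [← ind_congr i s.2]
      exact wt_le φ i _)
    (fun s => (iter_pos φ m s.1.1).le) (F' := fun s => ‖iter φ m‖ * 1)
    (fun s => by rw [mul_one]; exact iter_le_norm φ m _) j s
  refine h1.trans ?_
  rw [branchSum_iterate_const_mul, branchSum_iterate_weight_mul]
  have h2 := branchSum_iterate_comp (β := brPair) (β' := br)
    (k := fun i p => ind i p * tfac p ^ α) (π := fun s : SamePlane P => s.1.2)
    (fun i s => rfl) (fun _ => (1 : ℝ)) j s
  rw [h2]
  have hl := lowerRate_pos φ
  have h3 := lowerRate_pow_mul_norm_le φ j m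
  calc ‖iter φ m‖ * (Real.exp (⨆ x, φ x) ^ j
        * (branchSum br fun i p => ind i p * tfac p ^ α)^[j] (fun _ => 1) s.1.2)
      ≤ ‖iter φ m‖ * (Real.exp (⨆ x, φ x) ^ j * (C * (5 / 4) ^ j)) := by
        gcongr
        exact h j _
    _ = C * (5 / 4 * Real.exp (⨆ x, φ x) / lowerRate φ) ^ j
        * (lowerRate φ ^ j * ‖iter φ m‖) := by
        have e : (5 / 4 * Real.exp (⨆ x, φ x) / lowerRate φ) ^ j * lowerRate φ ^ j
            = (5 / 4) ^ j * Real.exp (⨆ x, φ x) ^ j := by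
          rw [← mul_pow, ← mul_pow, div_mul_cancel₀ _ hl.ne']
        linear_combination -C * ‖iter φ m‖ * e
    _ ≤ _ := by gcongr

/-- Interpolation with t = r / α between the α-th moment, which decays at the rate μ, and the zeroth
moment, which is the iterate itself. The rate becomes μ ^ t. -/
theorem exists_branchSum_tfac_rpow_le (φ : C(Lam P, ℝ))
    (hμ : 5 / 4 * Real.exp (⨆ x, φ x) < lowerRate φ) {r : ℝ} (hr0 : 0 < r) (hr1 : r ≤ 1) :
    ∃ θ : ℝ, 0 < θ ∧ θ < 1 ∧ ∃ C : ℝ, 0 < C ∧ ∀ (j m : ℕ) (s : SamePlane P),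
      (branchSum brPair fun i s => wt φ i s.1.1 * tfac s.1.2 ^ r)^[j]
        (fun s => iter φ m s.1.1) s ≤ C * θ ^ j * ‖iter φ (j + m)‖ := by
  obtain ⟨α, hα, C, hC, h⟩ := exists_branchSum_tfac_pow_le φ
  have hα' : (1 : ℝ) < α := by exact_mod_cast hα
  have hα0 : (0 : ℝ) < α := by linarith
  set t : ℝ := r / α with ht
  have ht0 : 0 < t := by positivity
  have ht1 : t < 1 := by
    rw [ht, div_lt_one hα0]
    linarith
  set μ := 5 / 4 * Real.exp (⨆ x, φ x) / lowerRate φ with hμdef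
  have hμ0 : 0 < μ := div_pos (by positivity) (lowerRate_pos φ)
  have hμ1 : μ < 1 := (div_lt_one (lowerRate_pos φ)).2 hμ
  refine ⟨μ ^ t, Real.rpow_pos_of_pos hμ0 t, Real.rpow_lt_one hμ0.le hμ1 ht0, C ^ t,
    Real.rpow_pos_of_pos hC t, fun j m s => ?_⟩
  have hw : ∀ i (s : SamePlane P), wt φ i s.1.1 * tfac s.1.2 ^ r
      = wt φ i s.1.1 ^ (1 - t) * (wt φ i s.1.1 * tfac s.1.2 ^ α) ^ t := by
    intro i s
    have h0 := wt_nonneg φ i s.1.1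
    rw [Real.mul_rpow h0 (pow_nonneg (tfac_nonneg _) _), ← mul_assoc,
      ← Real.rpow_add' h0 (by norm_num), ← Real.rpow_natCast, ← Real.rpow_mul (tfac_nonneg _)]
    rw [ht, mul_div_cancel₀ _ hα0.ne']
    norm_num
  have hF : ∀ s : SamePlane P, iter φ m s.1.1
      = iter φ m s.1.1 ^ (1 - t) * iter φ m s.1.1 ^ t := by
    intro s
    rw [← Real.rpow_add (iter_pos φ m _)]
    norm_num
  have h1 := branchSum_iterate_rpow_le (β := brPair) ht0 ht1
    (fun i (s : SamePlane P) => wt_nonneg φ i s.1.1)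
    (fun i s => mul_nonneg (wt_nonneg φ i s.1.1) (pow_nonneg (tfac_nonneg s.1.2) α))
    (fun s => (iter_pos φ m s.1.1).le) (fun s => (iter_pos φ m s.1.1).le) j s
  simp only [← hw, ← hF] at h1
  rw [branchSum_pair_iterate_iter] at h1
  refine h1.trans ?_
  have hn : 0 ≤ ‖iter φ (j + m)‖ := norm_nonneg _
  calc iter φ (j + m) s.1.1 ^ (1 - t) * _ ^ t
      ≤ ‖iter φ (j + m)‖ ^ (1 - t) * (C * μ ^ j * ‖iter φ (j + m)‖) ^ t := by
        refine mul_le_mul (Real.rpow_le_rpow (iter_pos φ _ _).le (iter_le_norm φ _ _)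
          (by linarith)) (Real.rpow_le_rpow ?_ (h j m s) ht0.le) ?_ (by positivity)
        · exact branchSum_iterate_nonneg
            (fun i s => mul_nonneg (wt_nonneg φ i _) (pow_nonneg (tfac_nonneg _) _))
            (fun s => (iter_pos φ m s.1.1).le) j s
        · refine Real.rpow_nonneg (branchSum_iterate_nonneg
            (fun i s => mul_nonneg (wt_nonneg φ i _) (pow_nonneg (tfac_nonneg _) _))
            (fun s => (iter_pos φ m s.1.1).le) j s) _
    _ = C ^ t * (μ ^ t) ^ j * (‖iter φ (j + m)‖ ^ (1 - t) * ‖iter φ (j + m)‖ ^ t) := by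
        rw [Real.mul_rpow (by positivity) hn, Real.mul_rpow hC.le (by positivity),
          Real.rpow_pow_comm hμ0.le]
        ring
    _ = C ^ t * (μ ^ t) ^ j * ‖iter φ (j + m)‖ := by
        rw [← Real.rpow_add' hn (by norm_num)]
        norm_num

/-! ### Decay of the central derivative on average -/

/-- The sum over all compositions of `j` branches of their weights times the `r`-th power of their
central derivative at the second point. -/
noncomputable def derSum (φ : C(Lam P, ℝ)) (r : ℝ) (j m : ℕ) : SamePlane P → ℝ :=
  (branchSum brPair fun i s => wt φ i s.1.1 * cder s.1.2 ^ r)^[j] fun s => iter φ m s.1.1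

/-- Exponential decay of `derSum`, relative to the growth of the transfer operator. -/
def DecaysOn (φ : C(Lam P, ℝ)) (r θ : ℝ) (Q : Set (SamePlane P)) : Prop :=
  ∃ C : ℝ, 0 ≤ C ∧ ∀ j m, ∀ s ∈ Q, derSum φ r j m s ≤ C * θ ^ j * ‖iter φ (j + m)‖

theorem derSum_nonneg (φ : C(Lam P, ℝ)) (r : ℝ) (j m : ℕ) (s : SamePlane P) :
    0 ≤ derSum φ r j m s := by
  unfold derSum
  exact branchSum_iterate_nonneg
    (fun i s => mul_nonneg (wt_nonneg φ i _) (Real.rpow_nonneg (cder_nonneg _) _))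
    (fun s => (iter_pos φ m s.1.1).le) j s

theorem DecaysOn.union {φ : C(Lam P, ℝ)} {r θ : ℝ} (hθ : 0 < θ) {Q Q' : Set (SamePlane P)}
    (h : DecaysOn φ r θ Q) (h' : DecaysOn φ r θ Q') : DecaysOn φ r θ (Q ∪ Q') := by
  obtain ⟨C, hC, h⟩ := h
  obtain ⟨C', hC', h'⟩ := h'
  refine ⟨C + C', by positivity, fun j m s hs => ?_⟩
  have h0 : 0 ≤ θ ^ j * ‖iter φ (j + m)‖ := by positivity
  have h1 : 0 ≤ C * (θ ^ j * ‖iter φ (j + m)‖) := mul_nonneg hC h0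
  have h2 : 0 ≤ C' * (θ ^ j * ‖iter φ (j + m)‖) := mul_nonneg hC' h0
  rcases hs with hs | hs
  · linarith [h j m s hs]
  · linarith [h' j m s hs]

theorem DecaysOn.mono {φ : C(Lam P, ℝ)} {r θ : ℝ} {Q Q' : Set (SamePlane P)}
    (h : DecaysOn φ r θ Q) (hQ : Q' ⊆ Q) : DecaysOn φ r θ Q' := by
  obtain ⟨C, hC, h⟩ := h
  exact ⟨C, hC, fun j m s hs => h j m s (hQ hs)⟩

/-- Away from the end points of the central direction, `derSum` is controlled by the projective
derivative. -/
theorem decaysOn_bfun (φ : C(Lam P, ℝ)) {r θ C : ℝ} (hr : 0 < r)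
    (h : ∀ (j m : ℕ) (s : SamePlane P),
      (branchSum brPair fun i s => wt φ i s.1.1 * tfac s.1.2 ^ r)^[j]
        (fun s => iter φ m s.1.1) s ≤ C * θ ^ j * ‖iter φ (j + m)‖)
    (hC : 0 < C) {η : ℝ} (hη : 0 < η) : DecaysOn φ r θ {s | η ≤ bfun s.1.2} := by
  refine ⟨C / η ^ r, by positivity, fun j m s hs => ?_⟩
  have hηr : 0 < η ^ r := Real.rpow_pos_of_pos hη r
  -- By `bfun_mul_cder` the weights with `cder` and with `tfac` differ by the coboundary of `bfun ^
  -- r`, which is at most 1 and, on this region, at least η ^ r.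
  have h1 := mul_branchSum_iterate (β := brPair)
    (w := fun s : SamePlane P => bfun s.1.2 ^ r)
    (g := fun i s => wt φ i s.1.1 * cder s.1.2 ^ r)
    (g' := fun i s => wt φ i s.1.1 * tfac s.1.2 ^ r)
    (fun i s => by
      have e := congrArg (· ^ r) (bfun_mul_cder i s.1.2)
      simp only [Real.mul_rpow (bfun_nonneg _) (cder_nonneg _),
        Real.mul_rpow (tfac_nonneg _) (bfun_nonneg _)] at e
      simp only [brPair]
      linear_combination wt φ i s.1.1 * e) (fun s => iter φ m s.1.1) j s
  have h2 := branchSum_iterate_mono (β := brPair)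
    (g := fun i s => wt φ i s.1.1 * tfac s.1.2 ^ r)
    (fun i s => mul_nonneg (wt_nonneg φ i _) (Real.rpow_nonneg (tfac_nonneg _) _))
    (fun _ _ => le_rfl) (F := fun s : SamePlane P => bfun s.1.2 ^ r * iter φ m s.1.1)
    (F' := fun s => iter φ m s.1.1)
    (fun s => mul_nonneg (Real.rpow_nonneg (bfun_nonneg _) _) (iter_pos φ m _).le)
    (fun s => mul_le_of_le_one_left (iter_pos φ m _).le
      (Real.rpow_le_one (bfun_nonneg _) (bfun_le_one _) hr.le)) j s
  have h3 : η ^ r * derSum φ r j m s ≤ bfun s.1.2 ^ r * derSum φ r j m s :=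
    mul_le_mul_of_nonneg_right (Real.rpow_le_rpow hη.le hs hr.le) (derSum_nonneg φ r j m s)
  have h4 : η ^ r * derSum φ r j m s ≤ C * θ ^ j * ‖iter φ (j + m)‖ :=
    (h3.trans_eq h1).trans (h2.trans (h j m s))
  rw [div_mul_eq_mul_div, div_mul_eq_mul_div, le_div_iff₀' hηr]
  exact h4

/-- A region that is mapped into itself by one branch only inherits the decay from the regions
reached by the other branch. -/
theorem DecaysOn.of_branches {φ : C(Lam P, ℝ)} {r θ : ℝ} (hr : 0 < r) (hθ : 0 < θ)
    (hrθ : Real.exp r * Real.exp (⨆ x, φ x) < θ * lowerRate φ) {Q Q' : Set (SamePlane P)}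
    (h : DecaysOn φ r θ Q') (hQt : ∀ s ∈ Q, brPair true s ∈ Q ∪ Q')
    (hQf : ∀ s ∈ Q, brPair false s ∈ Q') : DecaysOn φ r θ Q := by
  obtain ⟨C, hC, h⟩ := h
  set A := Real.exp r * Real.exp (⨆ x, φ x) with hA
  have hA0 : 0 < A := by positivity
  have hgap : 0 < θ * lowerRate φ - A := by linarith
  -- The 1 serves j = 0. The other entry solves A (K + 2C) ≤ K θ `lowerRate`: the two branches cost
  -- K + C and C, each with one-step weight at most A.
  set K := max 1 (2 * C * A / (θ * lowerRate φ - A)) with hK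
  have hK1 : 1 ≤ K := le_max_left _ _
  have hK2 : A * (K + 2 * C) ≤ K * (θ * lowerRate φ) := by
    have h2 : 2 * C * A / (θ * lowerRate φ - A) ≤ K := le_max_right _ _
    rw [div_le_iff₀ hgap] at h2
    linarith
  have hwt : ∀ i (s : SamePlane P), wt φ i s.1.1 * cder s.1.2 ^ r ≤ A := by
    intro i s
    rw [hA, mul_comm (Real.exp r)]
    refine mul_le_mul (wt_le' φ i _) ?_ (Real.rpow_nonneg (cder_nonneg _) _) (Real.exp_pos _).le
    rw [← Real.exp_one_rpow]
    exact Real.rpow_le_rpow (cder_nonneg _) (cder_le _) hr.le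
  refine ⟨K, by linarith, fun j m => ?_⟩
  induction j with
  | zero =>
    intro s _
    simp only [derSum, Function.iterate_zero, id_eq, pow_zero, mul_one, zero_add]
    nlinarith [iter_le_norm φ m s.1.1, norm_nonneg (iter φ m)]
  | succ j ih =>
    intro s hs
    have h0 : 0 ≤ θ ^ j * ‖iter φ (j + m)‖ := by positivity
    have hCX : 0 ≤ C * (θ ^ j * ‖iter φ (j + m)‖) := mul_nonneg hC h0
    have hKX : 0 ≤ K * (θ ^ j * ‖iter φ (j + m)‖) := mul_nonneg (by linarith) h0
    have ht : derSum φ r j m (brPair true s) ≤ (K + C) * (θ ^ j * ‖iter φ (j + m)‖) := by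
      rcases hQt s hs with h1 | h1
      · linarith [ih _ h1]
      · linarith [h j m _ h1]
    have hf : derSum φ r j m (brPair false s) ≤ C * (θ ^ j * ‖iter φ (j + m)‖) := by
      linarith [h j m _ (hQf s hs)]
    have hstep : derSum φ r (j + 1) m s
        = wt φ true s.1.1 * cder s.1.2 ^ r * derSum φ r j m (brPair true s)
          + wt φ false s.1.1 * cder s.1.2 ^ r * derSum φ r j m (brPair false s) := by
      simp only [derSum, Function.iterate_succ_apply', branchSum]
    rw [hstep]
    have h1 := mul_le_mul (hwt true s) ht (derSum_nonneg φ r j m _) hA0.le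
    have h2 := mul_le_mul (hwt false s) hf (derSum_nonneg φ r j m _) hA0.le
    have h3 := lowerRate_mul_norm_le φ (j + m)
    rw [show j + 1 + m = j + m + 1 by ring]
    calc _ ≤ A * (K + 2 * C) * (θ ^ j * ‖iter φ (j + m)‖) := by linarith
      _ ≤ K * (θ * lowerRate φ) * (θ ^ j * ‖iter φ (j + m)‖) :=
        mul_le_mul_of_nonneg_right hK2 h0
      _ = K * θ ^ (j + 1) * (lowerRate φ * ‖iter φ (j + m)‖) := by ring
      _ ≤ _ := by gcongr

theorem f_le_half {y : ℝ} (hy : y ∈ Set.Icc (0 : ℝ) 1) (h : y ≤ 1 / 6) : f y ≤ 1 / 2 := by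
  have he := exp_one_lt_three
  rw [f_eq hy.1, div_le_iff₀ (den_f_pos hy)]
  nlinarith [hy.1]

/-- The end regions are handled in reverse order of the dynamics. From the upper plane with y ≤ 1/2
both branches enter the middle region, where `bfun` is bounded below. The bottom of the lower plane
returns to itself by one branch only, the upper plane with y ≥ 1/2 falls to that bottom, and the top
of the lower plane returns to itself by one branch and otherwise enters y ≥ 1/2. Along a single
returning branch, even expansion by e ^ r at each step is outgrown by the operator. -/
theorem decaysOn_univ {φ : C(Lam P, ℝ)} {r θ C : ℝ} (hr : 0 < r) (hθ : 0 < θ)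
    (hrθ : Real.exp r * Real.exp (⨆ x, φ x) < θ * lowerRate φ)
    (h : ∀ (j m : ℕ) (s : SamePlane P),
      (branchSum brPair fun i s => wt φ i s.1.1 * tfac s.1.2 ^ r)^[j]
        (fun s => iter φ m s.1.1) s ≤ C * θ ^ j * ‖iter φ (j + m)‖)
    (hC : 0 < C) : DecaysOn φ r θ Set.univ := by
  have hσ := P.σ_pos
  have hσ' := P.σ_lt
  have hint := decaysOn_bfun φ hr h hC (η := (P.σ / 2) ^ 2) (by positivity)
  have hmid : ∀ p : Lam P, P.σ / 2 ≤ p.1.2.1 → P.σ / 2 ≤ 1 - p.1.2.1 →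
      (P.σ / 2) ^ 2 ≤ bfun p := by
    intro p h1 h2
    rw [sq]
    exact mul_le_mul h1 h2 (by linarith) (by linarith)
  have hup1 : DecaysOn φ r θ {s : SamePlane P | s.1.2 ∉ low P ∧ s.1.2.1.2.1 ≤ 1 / 2} := by
    have key : ∀ s ∈ {s : SamePlane P | s.1.2 ∉ low P ∧ s.1.2.1.2.1 ≤ 1 / 2}, ∀ i,
        brPair i s ∈ {s : SamePlane P | (P.σ / 2) ^ 2 ≤ bfun s.1.2} := by
      rintro s ⟨hs, hy⟩ i
      have hy' := y_mem s.1.2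
      have e := br_y_up i hs
      exact hmid (br i s.1.2) (by rw [e]; nlinarith) (by rw [e]; nlinarith [hy'.1])
    exact hint.of_branches hr hθ hrθ (fun s hs => Or.inr (key s hs true)) fun s hs => key s hs false
  have hbot : DecaysOn φ r θ {s : SamePlane P | s.1.2 ∈ low P ∧ s.1.2.1.2.1 ≤ P.σ / 2} := by
    refine (hint.union hθ hup1).of_branches hr hθ hrθ ?_ ?_
    · rintro s ⟨hs, hy⟩
      have e := br_y_low true hs
      have h2 := f_le_half (y_mem s.1.2) (by linarith)
      by_cases hc : f s.1.2.1.2.1 ≤ P.σ / 2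
      · exact Or.inl ⟨br_true_mem_low _, by simpa only [brPair, e] using hc⟩
      · push Not at hc
        exact Or.inr (Or.inl (hmid (br true s.1.2) (by rw [e]; linarith) (by rw [e]; linarith)))
    · rintro s ⟨hs, hy⟩
      have e := br_y_low false hs
      refine Or.inr ⟨fun h => br_false_mem_low.1 h hs, ?_⟩
      have h2 := f_le_half (y_mem s.1.2) (by linarith)
      simpa only [brPair, e] using h2
  have hup2 : DecaysOn φ r θ {s : SamePlane P | s.1.2 ∉ low P ∧ 1 / 2 ≤ s.1.2.1.2.1} := by
    have key : ∀ s ∈ {s : SamePlane P | s.1.2 ∉ low P ∧ 1 / 2 ≤ s.1.2.1.2.1}, ∀ i,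
        brPair i s ∈ {s : SamePlane P | s.1.2 ∈ low P ∧ s.1.2.1.2.1 ≤ P.σ / 2} := by
      rintro s ⟨hs, hy⟩ i
      have e := br_y_up i hs
      refine ⟨?_, ?_⟩
      · cases i
        · exact br_false_mem_low.2 hs
        · exact br_true_mem_low _
      · change (br i s.1.2).1.2.1 ≤ P.σ / 2
        rw [e]
        nlinarith
    exact hbot.of_branches hr hθ hrθ (fun s hs => Or.inr (key s hs true)) fun s hs => key s hs false
  have htop : DecaysOn φ r θ {s : SamePlane P | s.1.2 ∈ low P ∧ 1 - P.σ / 2 ≤ s.1.2.1.2.1} := by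
    refine hup2.of_branches hr hθ hrθ ?_ ?_
    · rintro s ⟨hs, hy⟩
      have e := br_y_low true hs
      refine Or.inl ⟨br_true_mem_low _, ?_⟩
      simpa only [brPair, e] using hy.trans (le_f (y_mem s.1.2))
    · rintro s ⟨hs, hy⟩
      have e := br_y_low false hs
      refine ⟨fun h => br_false_mem_low.1 h hs, ?_⟩
      have h2 : 1 / 2 ≤ f s.1.2.1.2.1 := by linarith [le_f (y_mem s.1.2)]
      simpa only [brPair, e] using h2
  refine ((((hint.union hθ hup1).union hθ hbot).union hθ hup2).union hθ htop).mono ?_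
  intro s _
  by_cases hs : s.1.2 ∈ low P
  · rcases le_total s.1.2.1.2.1 (P.σ / 2) with h1 | h1
    · exact Or.inl (Or.inl (Or.inr ⟨hs, h1⟩))
    · rcases le_total (1 - P.σ / 2) s.1.2.1.2.1 with h2 | h2
      · exact Or.inr ⟨hs, h2⟩
      · exact Or.inl (Or.inl (Or.inl (Or.inl (hmid _ h1 (by linarith)))))
  · rcases le_total s.1.2.1.2.1 (1 / 2) with h1 | h1
    · exact Or.inl (Or.inl (Or.inl (Or.inr ⟨hs, h1⟩)))
    · exact Or.inl (Or.inr ⟨hs, h1⟩)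

end HorseshoeProjection

/-! ### Distortion of the iterates of the transfer operator -/

namespace HorseshoeProjection

open Real (goldenRatio)

variable {P : Params}

/-- The only use of the oscillation bound: exp (sup φ) < √ω exp (inf φ). The first inequality needs
5/4 < √ω, the second e^(1/10) < 1.134 = 0.9 · 1.26 with 1.26 < √ω; this is where the restrictions r
≤ 1/10 and θ ≥ 9/10 come from. -/
theorem exp_iSup_lt {φ : C(Lam P, ℝ)}
    (hvar : (⨆ x, φ x) - (⨅ x, φ x) < Real.log goldenRatio / 2) :
    5 / 4 * Real.exp (⨆ x, φ x) < lowerRate φ ∧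
      Real.exp (1 / 10) * Real.exp (⨆ x, φ x) < 9 / 10 * lowerRate φ := by
  set q := Real.exp (Real.log goldenRatio / 2) with hq
  have hq0 : 0 < q := Real.exp_pos _
  have hqq : q * q = goldenRatio := by
    rw [hq, ← Real.exp_add, add_halves, Real.exp_log Real.goldenRatio_pos]
  have hω : (1.6 : ℝ) < goldenRatio := by
    have h5 : (2.2 : ℝ) < Real.sqrt 5 := Real.lt_sqrt_of_sq_lt (by norm_num)
    unfold Real.goldenRatio
    linarith
  have hq1 : 1.26 < q := by nlinarith
  have he : Real.exp (1 / 10) < 1.134 := by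
    have h : Real.exp (1 / 10) ^ 10 = Real.exp 1 := by
      rw [← Real.exp_nat_mul]
      norm_num
    refine lt_of_pow_lt_pow_left₀ 10 (by norm_num) ?_
    rw [h]
    exact Real.exp_one_lt_d9.trans (by norm_num)
  have hI : 0 < Real.exp (⨅ x, φ x) := Real.exp_pos _
  have hS : Real.exp (⨆ x, φ x) < Real.exp (⨅ x, φ x) * q := by
    rw [hq, ← Real.exp_add]
    exact Real.exp_lt_exp.2 (by linarith)
  have hS0 : 0 < Real.exp (⨆ x, φ x) := Real.exp_pos _
  have hl : lowerRate φ = Real.exp (⨅ x, φ x) * q * q := by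
    rw [lowerRate, ← hqq]
    ring
  have hIq : 0 < Real.exp (⨅ x, φ x) * q := mul_pos hI hq0
  rw [hl]
  constructor <;> nlinarith

/-- Cauchy–Schwarz over compositions of branches separates the derivatives at the two points,
leaving two sums controlled by `decaysOn_univ`. -/
theorem exists_branchSum_sqrt_cder_le (φ : C(Lam P, ℝ))
    (hvar : (⨆ x, φ x) - (⨅ x, φ x) < Real.log goldenRatio / 2) {r : ℝ} (hr0 : 0 < r)
    (hr1 : r ≤ 1 / 10) :
    ∃ θ : ℝ, 0 < θ ∧ θ < 1 ∧ P.ρ ^ r ≤ θ ∧ ∃ C : ℝ, 0 ≤ C ∧ ∀ (j m : ℕ) (s : SamePlane P),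
      (branchSum brPair fun i s =>
          wt φ i s.1.1 * (Real.sqrt (cder s.1.1) * Real.sqrt (cder s.1.2)) ^ r)^[j]
        (fun s => iter φ m s.1.1) s ≤ C * θ ^ j * ‖iter φ (j + m)‖ := by
  obtain ⟨h1, h2⟩ := exp_iSup_lt hvar
  obtain ⟨θ₀, hθ0, hθ1, C, hC, h⟩ := exists_branchSum_tfac_rpow_le φ h1 hr0 (by linarith)
  -- θ₀ is the projective rate, 9/10 is needed near the end points, and ρ ^ r is the contraction in
  -- the x-direction.
  set θ := max (max θ₀ (9 / 10)) (P.ρ ^ r) with hθ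
  have hθ₀ : θ₀ ≤ θ := (le_max_left _ _).trans (le_max_left _ _)
  have hθ9 : 9 / 10 ≤ θ := (le_max_right _ _).trans (le_max_left _ _)
  have hθp : 0 < θ := by linarith
  have hlt : θ < 1 := by
    refine max_lt (max_lt hθ1 (by norm_num)) (Real.rpow_lt_one P.ρ_pos.le ?_ hr0)
    linarith [P.ρ_lt]
  have hrθ : Real.exp r * Real.exp (⨆ x, φ x) < θ * lowerRate φ := by
    calc Real.exp r * Real.exp (⨆ x, φ x)
        ≤ Real.exp (1 / 10) * Real.exp (⨆ x, φ x) := by gcongr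
      _ < 9 / 10 * lowerRate φ := h2
      _ ≤ θ * lowerRate φ := mul_le_mul_of_nonneg_right hθ9 (lowerRate_pos φ).le
  obtain ⟨K, hK, hd⟩ := decaysOn_univ hr0 hθp hrθ (fun j m s => (h j m s).trans (by gcongr)) hC
  refine ⟨θ, hθp, hlt, le_max_right _ _, K, hK, fun j m s => ?_⟩
  have hw : ∀ i (s : SamePlane P),
      wt φ i s.1.1 * (Real.sqrt (cder s.1.1) * Real.sqrt (cder s.1.2)) ^ r
      = (wt φ i s.1.1 * cder s.1.1 ^ r) ^ (1 - (1 / 2 : ℝ))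
        * (wt φ i s.1.1 * cder s.1.2 ^ r) ^ (1 / 2 : ℝ) := by
    intro i s
    have h0 := wt_nonneg φ i s.1.1
    have ha := cder_nonneg s.1.1
    have hb := cder_nonneg s.1.2
    rw [show (1 : ℝ) - 1 / 2 = 1 / 2 by norm_num, ← Real.sqrt_eq_rpow, ← Real.sqrt_eq_rpow,
      Real.sqrt_mul h0, Real.sqrt_mul h0, Real.mul_rpow (Real.sqrt_nonneg _) (Real.sqrt_nonneg _)]
    have e : ∀ c : ℝ, 0 ≤ c → Real.sqrt (c ^ r) = Real.sqrt c ^ r := by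
      intro c hc
      rw [Real.sqrt_eq_rpow, Real.sqrt_eq_rpow, ← Real.rpow_mul hc, ← Real.rpow_mul hc, mul_comm]
    rw [e _ ha, e _ hb]
    have := Real.mul_self_sqrt h0
    linear_combination -(Real.sqrt (cder s.1.1) ^ r * Real.sqrt (cder s.1.2) ^ r) * this
  have hF : ∀ s : SamePlane P, iter φ m s.1.1
      = iter φ m s.1.1 ^ (1 - (1 / 2 : ℝ)) * iter φ m s.1.1 ^ (1 / 2 : ℝ) := by
    intro s
    rw [← Real.rpow_add (iter_pos φ m _)]
    norm_num
  have hg1 : ∀ i (s : SamePlane P), 0 ≤ wt φ i s.1.1 * cder s.1.1 ^ r := fun i s =>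
    mul_nonneg (wt_nonneg φ i s.1.1) (Real.rpow_nonneg (cder_nonneg _) _)
  have hg2 : ∀ i (s : SamePlane P), 0 ≤ wt φ i s.1.1 * cder s.1.2 ^ r := fun i s =>
    mul_nonneg (wt_nonneg φ i s.1.1) (Real.rpow_nonneg (cder_nonneg _) _)
  have hm : ∀ s : SamePlane P, 0 ≤ iter φ m s.1.1 := fun s => (iter_pos φ m s.1.1).le
  have key := branchSum_iterate_rpow_le (β := brPair) (t := 1 / 2) (by norm_num) (by norm_num)
    hg1 hg2 hm hm j s
  simp only [← hw, ← hF] at key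
  refine key.trans ?_
  -- The factor involving the first point alone is `derSum` at a diagonal pair.
  have hdiag : (branchSum brPair fun i s => wt φ i s.1.1 * cder s.1.1 ^ r)^[j]
      (fun s => iter φ m s.1.1) s = derSum φ r j m ⟨(s.1.1, s.1.1), Iff.rfl⟩ := by
    rw [derSum, branchSum_iterate_comp (β := brPair) (β' := br)
      (k := fun i p => wt φ i p * cder p ^ r) (π := fun s : SamePlane P => s.1.1)
      (fun i s => rfl) (iter φ m) j s]
    exact branchSum_iterate_comp (β := br) (β' := brPair)
      (k := fun i s => wt φ i s.1.1 * cder s.1.2 ^ r)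
      (π := fun p : Lam P => (⟨(p, p), Iff.rfl⟩ : SamePlane P))
      (fun i s => rfl) (fun s => iter φ m s.1.1) j s.1.1
  rw [hdiag, show (1 : ℝ) - 1 / 2 = 1 / 2 by norm_num, ← Real.sqrt_eq_rpow, ← Real.sqrt_eq_rpow]
  have hX : 0 ≤ K * θ ^ j * ‖iter φ (j + m)‖ := by positivity
  calc _ ≤ Real.sqrt (K * θ ^ j * ‖iter φ (j + m)‖) * Real.sqrt (K * θ ^ j * ‖iter φ (j + m)‖) :=
        mul_le_mul (Real.sqrt_le_sqrt (hd j m _ (Set.mem_univ _)))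
          (Real.sqrt_le_sqrt (hd j m s (Set.mem_univ _))) (Real.sqrt_nonneg _) (Real.sqrt_nonneg _)
    _ = _ := Real.mul_self_sqrt hX

/-- The `r`-th power of the distance contracts on average along the inverse branches. -/
theorem exists_branchSum_dist_le (φ : C(Lam P, ℝ))
    (hvar : (⨆ x, φ x) - (⨅ x, φ x) < Real.log goldenRatio / 2) {r : ℝ} (hr0 : 0 < r)
    (hr1 : r ≤ 1 / 10) :
    ∃ θ : ℝ, 0 < θ ∧ θ < 1 ∧ ∃ C : ℝ, 0 ≤ C ∧ ∀ (j m : ℕ) (s : SamePlane P),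
      (branchSum brPair fun i s => wt φ i s.1.1)^[j]
        (fun s => dist s.1.1 s.1.2 ^ r * iter φ m s.1.1) s
        ≤ C * θ ^ j * ‖iter φ (j + m)‖ * dist s.1.1 s.1.2 ^ r := by
  obtain ⟨θ, hθ0, hθ1, hρ, C, hC, h⟩ := exists_branchSum_sqrt_cder_le φ hvar hr0 hr1
  refine ⟨θ, hθ0, hθ1, C + 1, by linarith, fun j m s => ?_⟩
  -- The powers |Δx| ^ r and |Δy| ^ r act as coboundaries: pulling them out of the iterated sum
  -- turns each into the product of the one-step contraction factors.
  have hx := mul_branchSum_iterate (β := brPair)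
    (w := fun s : SamePlane P => |s.1.1.1.1 - s.1.2.1.1| ^ r)
    (g := fun i s => P.ρ ^ r * wt φ i s.1.1) (g' := fun i s => wt φ i s.1.1)
    (fun i s => by
      have e := abs_x_br_sub i s.2
      simp only [brPair, e, Real.mul_rpow P.ρ_pos.le (abs_nonneg _)]
      ring) (fun s => iter φ m s.1.1) j s
  have hy := mul_branchSum_iterate (β := brPair)
    (w := fun s : SamePlane P => |s.1.1.1.2.1 - s.1.2.1.2.1| ^ r)
    (g := fun i s => wt φ i s.1.1 * (Real.sqrt (cder s.1.1) * Real.sqrt (cder s.1.2)) ^ r)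
    (g' := fun i s => wt φ i s.1.1)
    (fun i s => by
      have e := abs_y_br_sub i s.2
      simp only [brPair, e, Real.mul_rpow
        (mul_nonneg (Real.sqrt_nonneg (cder s.1.1)) (Real.sqrt_nonneg (cder s.1.2)))
        (abs_nonneg _)]
      ring) (fun s => iter φ m s.1.1) j s
  rw [branchSum_iterate_weight_mul, branchSum_pair_iterate_iter] at hx
  have hsplit := branchSum_iterate_mono (β := brPair)
    (g := fun i (s : SamePlane P) => wt φ i s.1.1) (fun i s => wt_nonneg φ i _)
    (fun _ _ => le_rfl) (F := fun s => dist s.1.1 s.1.2 ^ r * iter φ m s.1.1)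
    (F' := fun s => |s.1.1.1.1 - s.1.2.1.1| ^ r * iter φ m s.1.1
      + |s.1.1.1.2.1 - s.1.2.1.2.1| ^ r * iter φ m s.1.1)
    (fun s => mul_nonneg (Real.rpow_nonneg dist_nonneg _) (iter_pos φ m _).le)
    (fun s => by
      rw [← add_mul]
      refine mul_le_mul_of_nonneg_right ?_ (iter_pos φ m _).le
      rw [dist_eq_max s.2]
      have h1 := Real.rpow_nonneg (abs_nonneg (s.1.1.1.1 - s.1.2.1.1)) r
      have h2 := Real.rpow_nonneg (abs_nonneg (s.1.1.1.2.1 - s.1.2.1.2.1)) r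
      rcases max_cases |s.1.1.1.1 - s.1.2.1.1| |s.1.1.1.2.1 - s.1.2.1.2.1| with h3 | h3 <;>
        rw [h3.1] <;> linarith) j s
  rw [branchSum_iterate_add, ← hx, ← hy] at hsplit
  refine hsplit.trans ?_
  have hdx : |s.1.1.1.1 - s.1.2.1.1| ^ r ≤ dist s.1.1 s.1.2 ^ r := by
    rw [dist_eq_max s.2]
    exact Real.rpow_le_rpow (abs_nonneg _) (le_max_left _ _) hr0.le
  have hdy : |s.1.1.1.2.1 - s.1.2.1.2.1| ^ r ≤ dist s.1.1 s.1.2 ^ r := by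
    rw [dist_eq_max s.2]
    exact Real.rpow_le_rpow (abs_nonneg _) (le_max_right _ _) hr0.le
  have hd0 : 0 ≤ dist s.1.1 s.1.2 ^ r := Real.rpow_nonneg dist_nonneg _
  have hρ0 : 0 ≤ P.ρ ^ r := Real.rpow_nonneg P.ρ_pos.le _
  have i1 : (P.ρ ^ r) ^ j * iter φ (j + m) s.1.1 ≤ θ ^ j * ‖iter φ (j + m)‖ :=
    mul_le_mul (pow_le_pow_left₀ hρ0 hρ j) (iter_le_norm φ _ _) (iter_pos φ _ _).le (by positivity)
  have b1 := mul_le_mul hdx i1 (mul_nonneg (pow_nonneg hρ0 _) (iter_pos φ _ _).le) hd0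
  have b2 := mul_le_mul hdy (h j m s) (branchSum_iterate_nonneg (fun i s => mul_nonneg
    (wt_nonneg φ i _) (Real.rpow_nonneg (mul_nonneg (Real.sqrt_nonneg _) (Real.sqrt_nonneg _)) _))
    (fun s => (iter_pos φ m s.1.1).le) j s) hd0
  linarith

/-! ### Averaged distortion and comparison of values -/

/-- The accumulated distortion of the weights of the branches along `n` steps. -/
noncomputable def distortion (φ : C(Lam P, ℝ)) (K r : ℝ) : ℕ → SamePlane P → ℝ
  | 0 => fun _ => 0
  | n + 1 => branchSum brPair (fun i s => wt φ i s.1.1) fun s =>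
      K * (dist s.1.1 s.1.2 ^ r * iter φ n s.1.1) + distortion φ K r n s

/-- Unrolled, the distortion is a sum over k from 1 to n of the k-step averages of K d ^ r, each O(θ
^ k) relative to the norm of the n-th iterate: a geometric series. -/
theorem exists_distortion_le (φ : C(Lam P, ℝ))
    (hvar : (⨆ x, φ x) - (⨅ x, φ x) < Real.log goldenRatio / 2) {K r : ℝ} (hK : 0 ≤ K)
    (hr0 : 0 < r) (hr1 : r ≤ 1 / 10) :
    ∃ D : ℝ, 0 ≤ D ∧ ∀ (n : ℕ) (s : SamePlane P),
      distortion φ K r n s ≤ D * ‖iter φ n‖ * dist s.1.1 s.1.2 ^ r := by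
  obtain ⟨θ, hθ0, hθ1, C, hC, h⟩ := exists_branchSum_dist_le φ hvar hr0 hr1
  have h1θ : 0 < 1 - θ := by linarith
  -- The k further averages are needed because unrolling the recursion raises k by one.
  have key : ∀ (n k : ℕ) (s : SamePlane P),
      (branchSum brPair fun i s => wt φ i s.1.1)^[k] (distortion φ K r n) s
        ≤ K * C / (1 - θ) * θ ^ k * ‖iter φ (k + n)‖ * dist s.1.1 s.1.2 ^ r := by
    intro n
    induction n with
    | zero =>
      intro k s
      have h0 := branchSum_iterate_const_mul (β := brPair)
        (g := fun i (s : SamePlane P) => wt φ i s.1.1) 0 (fun _ => 0) k s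
      simp only [zero_mul] at h0
      rw [show distortion φ K r 0 = fun _ => 0 from rfl, h0]
      have : 0 ≤ dist s.1.1 s.1.2 ^ r := Real.rpow_nonneg dist_nonneg _
      positivity
    | succ n ih =>
      intro k s
      have e : (branchSum brPair fun i s => wt φ i s.1.1)^[k] (distortion φ K r (n + 1)) s
          = (branchSum brPair fun i s => wt φ i s.1.1)^[k + 1] (fun s =>
            K * (dist s.1.1 s.1.2 ^ r * iter φ n s.1.1) + distortion φ K r n s) s := by
        rw [Function.iterate_succ_apply]
        rfl
      rw [e, branchSum_iterate_add, branchSum_iterate_const_mul]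
      have i1 := mul_le_mul_of_nonneg_left (h (k + 1) n s) hK
      have i2 := ih (k + 1) s
      rw [show k + 1 + n = k + (n + 1) by ring] at i1 i2
      set X := ‖iter φ (k + (n + 1))‖ * dist s.1.1 s.1.2 ^ r with hX
      -- The identity 1/(1 - θ) = θ + θ/(1 - θ) + (1 - θ); the last term is discarded.
      have e2 : K * C / (1 - θ) * θ ^ k * X
          = K * (C * θ ^ (k + 1) * X) + K * C / (1 - θ) * θ ^ (k + 1) * X
            + K * C * θ ^ k * X * (1 - θ) := by
        field_simp
        ring
      have hX0 : 0 ≤ X := mul_nonneg (norm_nonneg _) (Real.rpow_nonneg dist_nonneg _)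
      have hpos : 0 ≤ K * C * θ ^ k * X * (1 - θ) := by positivity
      rw [mul_assoc _ _ (dist s.1.1 s.1.2 ^ r), ← hX] at i1 i2 ⊢
      rw [e2]
      exact (add_le_add i1 i2).trans (le_add_of_nonneg_right hpos)
  refine ⟨K * C / (1 - θ), by positivity, fun n s => ?_⟩
  simpa using key n 0 s

/-- Jensen's inequality for exp, one step at a time. Individual compositions may have large
distortion; only the mean of the distortion, weighted by the terms of the iterate at the first
point, enters the exponent. -/
theorem iter_mul_exp_le (φ : C(Lam P, ℝ)) {K r : ℝ}
    (hφ : ∀ p q, |φ p - φ q| ≤ K * dist p q ^ r) (n : ℕ) (s : SamePlane P) :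
    iter φ n s.1.1 * Real.exp (-(distortion φ K r n s / iter φ n s.1.1)) ≤ iter φ n s.1.2 := by
  induction n generalizing s with
  | zero =>
    have h : perron P s.1.1 = perron P s.1.2 := by
      by_cases hs : s.1.1 ∈ low P
      · rw [perron_low hs, perron_low (s.2.1 hs)]
      · rw [perron_up hs, perron_up (mt s.2.2 hs)]
    simp [distortion, iter_zero, h]
  | succ n ih =>
    set A : Bool → ℝ := fun i => wt φ i s.1.1 * iter φ n (br i s.1.1) with hA
    set x : Bool → ℝ := fun i => K * dist (br i s.1.1) (br i s.1.2) ^ r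
      + distortion φ K r n (brPair i s) / iter φ n (br i s.1.1) with hx
    have hA0 : ∀ i, 0 ≤ A i := fun i => mul_nonneg (wt_nonneg φ i _) (iter_pos φ n _).le
    have hT : iter φ (n + 1) s.1.1 = A true + A false := iter_succ_apply φ n _
    have hTpos : 0 < A true + A false := hT ▸ iter_pos φ (n + 1) _
    have hM : distortion φ K r (n + 1) s = A true * x true + A false * x false := by
      have h1 := (iter_pos φ n (br true s.1.1)).ne'
      have h2 := (iter_pos φ n (br false s.1.1)).ne'
      simp only [distortion, branchSum, hA, hx, brPair]
      field_simp
    -- z is the weighted mean of the exponents; the tangent to exp (-x) at z, summed against the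
    -- weights, loses its linear term.
    set z := (A true * x true + A false * x false) / (A true + A false) with hz
    have hzA : z * (A true + A false) = A true * x true + A false * x false :=
      div_mul_cancel₀ _ hTpos.ne'
    have hterm : ∀ i, A i * (Real.exp (-z) * (1 + z - x i))
        ≤ wt φ i s.1.2 * iter φ n (br i s.1.2) := by
      intro i
      have h1 : Real.exp (-z) * (1 + z - x i) ≤ Real.exp (-x i) := by
        have h2 := Real.add_one_le_exp (z - x i)
        calc Real.exp (-z) * (1 + z - x i) ≤ Real.exp (-z) * Real.exp (z - x i) := by
              gcongr
              linarith
          _ = Real.exp (-x i) := by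
              rw [← Real.exp_add]
              congr 1
              ring
      refine (mul_le_mul_of_nonneg_left h1 (hA0 i)).trans ?_
      have h3 : wt φ i s.1.1 * Real.exp (-(K * dist (br i s.1.1) (br i s.1.2) ^ r))
          ≤ wt φ i s.1.2 := by
        rw [wt, wt, ind_congr i s.2, mul_assoc, ← Real.exp_add]
        refine mul_le_mul_of_nonneg_left (Real.exp_le_exp.2 ?_) (ind_nonneg i _)
        linarith [(abs_le.1 (hφ (br i s.1.1) (br i s.1.2))).2]
      have h4 := mul_le_mul h3 (ih (brPair i s))
        (mul_nonneg (iter_pos φ n _).le (Real.exp_pos _).le) (wt_nonneg φ i _)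
      refine le_trans (le_of_eq ?_) h4
      simp only [hA, hx, brPair]
      rw [neg_add, Real.exp_add]
      ring
    rw [hT, hM, iter_succ_apply φ n s.1.2, branchSum, ← hz]
    have h5 := add_le_add (hterm true) (hterm false)
    refine le_trans (le_of_eq ?_) h5
    linear_combination -Real.exp (-z) * hzA

/-- The iterates are uniformly Hölder continuous and bounded below, relative to their norm. -/
theorem exists_iter_bounds (φ : C(Lam P, ℝ))
    (hvar : (⨆ x, φ x) - (⨅ x, φ x) < Real.log goldenRatio / 2) {K r : ℝ}
    (hφ : ∀ p q, |φ p - φ q| ≤ K * dist p q ^ r) (hK : 0 ≤ K) (hr0 : 0 < r) (hr1 : r ≤ 1 / 10) :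
    (∃ D : ℝ, 0 ≤ D ∧ ∀ n p q, |iter φ n p - iter φ n q| ≤ D * ‖iter φ n‖ * dist p q ^ r) ∧
      ∃ c : ℝ, 0 < c ∧ ∀ n p, c * ‖iter φ n‖ ≤ iter φ n p := by
  obtain ⟨D, hD, h⟩ := exists_distortion_le φ hvar hK hr0 hr1
  have hd0 : ∀ p q : Lam P, 0 ≤ dist p q ^ r := fun p q => Real.rpow_nonneg dist_nonneg _
  constructor
  · refine ⟨D + 2, by linarith, ?_⟩
    have key : ∀ n p q, iter φ n p - iter φ n q ≤ (D + 2) * ‖iter φ n‖ * dist p q ^ r := by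
      intro n p q
      have hn : 0 ≤ ‖iter φ n‖ * dist p q ^ r := mul_nonneg (norm_nonneg _) (hd0 p q)
      by_cases hpq : p ∈ low P ↔ q ∈ low P
      · have h1 := iter_mul_exp_le φ hφ n ⟨(p, q), hpq⟩
        have h2 := h n ⟨(p, q), hpq⟩
        simp only at h1 h2
        have hp := iter_pos φ n p
        have h3 := Real.add_one_le_exp
          (-(distortion φ K r n ⟨(p, q), hpq⟩ / iter φ n p))
        have h4 := mul_le_mul_of_nonneg_left h3 hp.le
        have h5 : iter φ n p * (-(distortion φ K r n ⟨(p, q), hpq⟩ / iter φ n p) + 1)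
            = iter φ n p - distortion φ K r n ⟨(p, q), hpq⟩ := by
          field_simp
          ring
        linarith
      -- Across planes the distance exceeds 1/2, so the summand 2 in D + 2 already covers the full
      -- norm.
      · have h1 := dist_of_not_iff hpq
        have h2 : dist p q ≤ dist p q ^ r := by
          have := Real.rpow_le_rpow_of_exponent_ge (by linarith) (dist_le_one p q)
            (show r ≤ 1 by linarith)
          rwa [Real.rpow_one] at this
        have h3 := iter_le_norm φ n p
        have h4 := iter_pos φ n q
        have h5 : ‖iter φ n‖ * (1 / 2) ≤ ‖iter φ n‖ * dist p q ^ r :=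
          mul_le_mul_of_nonneg_left (by linarith) (norm_nonneg _)
        have h6 := mul_nonneg hD hn
        linarith
    intro n p q
    refine abs_le.2 ⟨?_, key n p q⟩
    have h1 := key n q p
    rw [dist_comm] at h1
    linarith
  · set i₀ := Real.exp (⨅ x, φ x) with hi₀
    set s₀ := 2 * Real.exp (⨆ x, φ x) with hs₀
    have hi : 0 < i₀ := Real.exp_pos _
    have hs : 0 < s₀ := by positivity
    set c₀ := Real.exp (-D) with hc₀
    have hc : 0 < c₀ := Real.exp_pos _
    -- At a maximum point the mean distortion is at most D, since distances are at most 1.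
    have hsame : ∀ n p q, (p ∈ low P ↔ q ∈ low P) → iter φ n p = ‖iter φ n‖ →
        c₀ * ‖iter φ n‖ ≤ iter φ n q := by
      intro n p q hpq hp
      have h1 := iter_mul_exp_le φ hφ n ⟨(p, q), hpq⟩
      have h2 := h n ⟨(p, q), hpq⟩
      simp only at h1 h2
      have hpos := iter_pos φ n p
      refine le_trans ?_ h1
      rw [hp] at hpos ⊢
      rw [mul_comm]
      refine mul_le_mul_of_nonneg_left (Real.exp_le_exp.2 (neg_le_neg ?_)) hpos.le
      rw [div_le_iff₀ hpos]
      refine h2.trans (mul_le_of_le_one_right (by positivity) ?_)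
      exact Real.rpow_le_one dist_nonneg (dist_le_one p q) hr0.le
    have hstep : ∀ n p, i₀ * iter φ n (br true p) ≤ iter φ (n + 1) p ∧
        (p ∈ low P → i₀ * iter φ n (br false p) ≤ iter φ (n + 1) p) := by
      intro n p
      have a1 := mul_le_mul_of_nonneg_right (exp_iInf_le_exp φ (br true p))
        (iter_pos φ n (br true p)).le
      have a2 := mul_le_mul_of_nonneg_right (exp_iInf_le_exp φ (br false p))
        (iter_pos φ n (br false p)).le
      have a3 := mul_pos hi (iter_pos φ n (br true p))
      have a4 := mul_pos hi (iter_pos φ n (br false p))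
      rw [iter_succ_apply]
      by_cases hp : p ∈ low P
      · rw [branchSum_wt_low φ _ hp]
        exact ⟨by linarith, fun _ => by linarith⟩
      · rw [branchSum_wt_up φ _ hp]
        exact ⟨a1, fun h => absurd h hp⟩
    -- Primitivity in two steps: every point has a preimage in the lower plane, and a lower point
    -- has preimages in both planes, in particular in the plane of the maximum.
    have htwo : ∀ n q, i₀ * (i₀ * (c₀ * ‖iter φ n‖)) ≤ iter φ (n + 2) q := by
      intro n q
      obtain ⟨p, hp⟩ : ∃ p, iter φ n p = ‖iter φ n‖ := by
        obtain ⟨p, -, hp⟩ := isCompact_univ.exists_isMaxOn ⟨q, Set.mem_univ _⟩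
          (iter φ n).continuous.continuousOn
        refine ⟨p, le_antisymm (iter_le_norm φ n p) ?_⟩
        refine (ContinuousMap.norm_le _ (iter_pos φ n p).le).2 fun x => ?_
        rw [Real.norm_of_nonneg (iter_pos φ n x).le]
        exact hp (Set.mem_univ x)
      have hlow : ∀ q ∈ low P, i₀ * (c₀ * ‖iter φ n‖) ≤ iter φ (n + 1) q := by
        intro q hq
        by_cases hpl : p ∈ low P
        · refine le_trans (mul_le_mul_of_nonneg_left ?_ hi.le) (hstep n q).1
          exact hsame n p _ (by simp [hpl, br_true_mem_low]) hp
        · refine le_trans (mul_le_mul_of_nonneg_left ?_ hi.le) ((hstep n q).2 hq)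
          exact hsame n p _ (by simp [hpl, br_false_mem_low, hq]) hp
      exact (mul_le_mul_of_nonneg_left (hlow _ (br_true_mem_low q)) hi.le).trans
        (hstep (n + 1) q).1
    have hone : ∀ p, 1 ≤ iter φ 0 p := one_le_perron
    have hl := lowerRate_pos φ
    -- The three entries serve n = 0, n = 1 and n ≥ 2, the last being the range of `htwo`.
    refine ⟨min (min (1 / goldenRatio) (lowerRate φ / (s₀ * goldenRatio)))
      (i₀ * i₀ * c₀ / (s₀ * s₀)), ?_, ?_⟩
    · have := Real.goldenRatio_pos
      positivity
    · intro n p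
      have hω := Real.goldenRatio_pos
      have hn0 : ‖iter φ 0‖ ≤ goldenRatio := by
        refine (ContinuousMap.norm_le _ hω.le).2 fun x => ?_
        rw [Real.norm_of_nonneg (iter_pos φ 0 x).le]
        exact perron_le x
      match n with
      | 0 =>
        calc _ ≤ 1 / goldenRatio * goldenRatio :=
              mul_le_mul ((min_le_left _ _).trans (min_le_left _ _)) hn0 (norm_nonneg _)
                (by positivity)
          _ = 1 := by field_simp
          _ ≤ _ := hone p
      | 1 =>
        calc _ ≤ lowerRate φ / (s₀ * goldenRatio) * (s₀ * goldenRatio) :=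
              mul_le_mul ((min_le_left _ _).trans (min_le_right _ _))
                ((norm_iter_succ_le φ 0).trans (mul_le_mul_of_nonneg_left hn0 hs.le))
                (norm_nonneg _) (by positivity)
          _ = lowerRate φ * 1 := by field_simp
          _ ≤ lowerRate φ * iter φ 0 p := mul_le_mul_of_nonneg_left (hone p) hl.le
          _ ≤ _ := (iter_pos_and_le φ 0 p).2
      | n + 2 =>
        calc _ ≤ i₀ * i₀ * c₀ / (s₀ * s₀) * (s₀ * (s₀ * ‖iter φ n‖)) :=
              mul_le_mul (min_le_right _ _) ((norm_iter_succ_le φ (n + 1)).trans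
                (mul_le_mul_of_nonneg_left (norm_iter_succ_le φ n) hs.le))
                (norm_nonneg _) (by positivity)
          _ = i₀ * (i₀ * (c₀ * ‖iter φ n‖)) := by field_simp
          _ ≤ _ := htwo n p

end HorseshoeProjection

/-! ### Generalized Cesàro limits -/

namespace HorseshoeProjection

open Filter Topology

/-- The Cesàro averages of a sequence. -/
noncomputable def cesaro (u : ℕ → ℝ) (n : ℕ) : ℝ := (∑ k ∈ Finset.range (n + 1), u k) / (n + 1)

/-- The limit of the Cesàro averages along an ultrafilter. -/
noncomputable def cesaroLim (u : ℕ → ℝ) : ℝ := limUnder (hyperfilter ℕ : Filter ℕ) (cesaro u)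

theorem cesaro_mem_Icc {u : ℕ → ℝ} {a b : ℝ} (h : ∀ n, u n ∈ Set.Icc a b) (n : ℕ) :
    cesaro u n ∈ Set.Icc a b := by
  have hn : (0 : ℝ) < n + 1 := by positivity
  have h1 := Finset.card_nsmul_le_sum (Finset.range (n + 1)) u a fun k _ => (h k).1
  have h2 := Finset.sum_le_card_nsmul (Finset.range (n + 1)) u b fun k _ => (h k).2
  rw [Finset.card_range, nsmul_eq_mul] at h1 h2
  push_cast at h1 h2
  exact ⟨by rw [cesaro, le_div_iff₀ hn]; linarith, by rw [cesaro, div_le_iff₀ hn]; linarith⟩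

/-- A bounded sequence converges along any ultrafilter, by compactness; no equicontinuity or weak-*
compactness argument is needed later. -/
theorem tendsto_cesaroLim {u : ℕ → ℝ} {a b : ℝ} (h : ∀ n, u n ∈ Set.Icc a b) :
    Tendsto (cesaro u) (hyperfilter ℕ) (𝓝 (cesaroLim u)) := by
  refine tendsto_nhds_limUnder ?_
  obtain ⟨x, -, hx⟩ := (isCompact_Icc (a := a) (b := b)).ultrafilter_le_nhds
    ((hyperfilter ℕ).map (cesaro u))
    (le_principal_iff.2 (Filter.mem_map.2 (Filter.univ_mem' (cesaro_mem_Icc h))))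
  exact ⟨x, hx⟩

theorem cesaroLim_mem_Icc {u : ℕ → ℝ} {a b : ℝ} (h : ∀ n, u n ∈ Set.Icc a b) :
    cesaroLim u ∈ Set.Icc a b :=
  isClosed_Icc.mem_of_tendsto (tendsto_cesaroLim h)
    (Filter.univ_mem' (cesaro_mem_Icc h))

theorem cesaroLim_add_mul {u v : ℕ → ℝ} {a b a' b' : ℝ} (hu : ∀ n, u n ∈ Set.Icc a b)
    (hv : ∀ n, v n ∈ Set.Icc a' b') (c d : ℝ) :
    cesaroLim (fun n => c * u n + d * v n) = c * cesaroLim u + d * cesaroLim v := by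
  refine Tendsto.limUnder_eq ?_
  have h := ((tendsto_cesaroLim hu).const_mul c).add ((tendsto_cesaroLim hv).const_mul d)
  refine h.congr fun n => ?_
  simp only [cesaro, Finset.sum_add_distrib, ← Finset.mul_sum]
  ring

/-- A shift changes the n-th average by (u (n + 1) - u 0) / (n + 1), which tends to 0, and the
hyperfilter is finer than `atTop`. -/
theorem cesaroLim_succ {u : ℕ → ℝ} {a b : ℝ} (hu : ∀ n, u n ∈ Set.Icc a b) :
    cesaroLim (fun n => u (n + 1)) = cesaroLim u := by
  refine Tendsto.limUnder_eq ?_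
  have h0 : Tendsto (fun n : ℕ => (b - a) / ((n : ℝ) + 1)) atTop (𝓝 0) :=
    tendsto_const_nhds.div_atTop
      (tendsto_atTop_add_const_right _ _ tendsto_natCast_atTop_atTop)
  have h1 : Tendsto (fun n => (u (n + 1) - u 0) / ((n : ℝ) + 1)) atTop (𝓝 0) := by
    refine squeeze_zero_norm (fun n => ?_) h0
    have hn : (0 : ℝ) < n + 1 := by positivity
    rw [norm_div, Real.norm_of_nonneg hn.le]
    refine div_le_div_of_nonneg_right (abs_le.2 ⟨?_, ?_⟩) hn.le
    · linarith [(hu (n + 1)).1, (hu 0).2]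
    · linarith [(hu (n + 1)).2, (hu 0).1]
  have h2 := (tendsto_cesaroLim hu).add (h1.mono_left Nat.hyperfilter_le_atTop)
  rw [add_zero] at h2
  refine h2.congr fun n => ?_
  have h3 := Finset.sum_range_succ u (n + 1)
  have h4 := Finset.sum_range_succ' u (n + 1)
  simp only [cesaro]
  rw [← add_div]
  congr 1
  linarith

/-! ### Almost multiplicative sequences -/

/-- An almost multiplicative sequence is comparable to a geometric sequence. -/
theorem exists_geometric_of_almost_mul {a : ℕ → ℝ} (ha : ∀ n, 0 < a n) {d : ℝ} (hd : 0 < d)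
    (hle : ∀ n k, a (n + k) ≤ a n * a k) (hge : ∀ n k, d * (a n * a k) ≤ a (n + k)) :
    ∃ l : ℝ, 0 < l ∧ ∀ n, l ^ n ≤ a n ∧ d * a n ≤ l ^ n := by
  have h0 : 1 ≤ a 0 := by
    have := hle 0 0
    nlinarith [ha 0]
  have hd0 : d * a 0 ≤ 1 := by
    have := hge 0 0
    nlinarith [ha 0]
  have hd1 : d ≤ 1 := by nlinarith
  have hlow_pow : ∀ k n, (d * a (n + 1)) ^ (k + 1) ≤ d * a ((k + 1) * (n + 1)) := by
    intro k n
    induction k with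
    | zero => simp
    | succ k ih =>
      rw [show (k + 1 + 1) * (n + 1) = (n + 1) + (k + 1) * (n + 1) by ring, pow_succ']
      have h1 := mul_le_mul_of_nonneg_left ih (mul_pos hd (ha (n + 1))).le
      have h2 := mul_le_mul_of_nonneg_left (hge (n + 1) ((k + 1) * (n + 1))) hd.le
      linarith
  have hup_pow : ∀ k n, a ((k + 1) * (n + 1)) ≤ a (n + 1) ^ (k + 1) := by
    intro k n
    induction k with
    | zero => simp
    | succ k ih =>
      rw [show (k + 1 + 1) * (n + 1) = (n + 1) + (k + 1) * (n + 1) by ring, pow_succ']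
      exact (hle _ _).trans (mul_le_mul_of_nonneg_left ih (ha _).le)
  -- Fekete's argument: both quotients are compared at the common index (k + 1)(n + 1), since a is
  -- submultiplicative and d a is supermultiplicative. The supremum L of the left sides then lies
  -- below every right side.
  have hcomp : ∀ n k : ℕ, Real.log (d * a (n + 1)) / (n + 1) ≤ Real.log (a (k + 1)) / (k + 1) := by
    intro n k
    have h1 : (d * a (n + 1)) ^ (k + 1) ≤ a (k + 1) ^ (n + 1) := by
      refine (hlow_pow k n).trans ((mul_le_of_le_one_left (ha _).le hd1).trans ?_)
      rw [mul_comm]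
      exact hup_pow n k
    have h2 := Real.log_le_log (pow_pos (mul_pos hd (ha _)) _) h1
    rw [Real.log_pow, Real.log_pow] at h2
    push_cast at h2
    rw [div_le_div_iff₀ (by positivity) (by positivity)]
    linarith
  set L := ⨆ n : ℕ, Real.log (d * a (n + 1)) / (n + 1) with hL
  have hbdd : BddAbove (Set.range fun n : ℕ => Real.log (d * a (n + 1)) / (n + 1)) :=
    ⟨_, by rintro _ ⟨n, rfl⟩; exact hcomp n 0⟩
  refine ⟨Real.exp L, Real.exp_pos _, fun n => ?_⟩
  rcases n with _ | n
  · simpa using ⟨h0, hd0⟩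
  rw [← Real.exp_nat_mul, ← Real.le_log_iff_exp_le (ha _),
    ← Real.log_le_iff_le_exp (mul_pos hd (ha _))]
  have hn : (0 : ℝ) < n + 1 := by positivity
  constructor
  · have h1 : L ≤ Real.log (a (n + 1)) / (n + 1) := ciSup_le fun k => hcomp k n
    rw [le_div_iff₀ hn] at h1
    push_cast
    linarith
  · have h1 := le_ciSup hbdd n
    rw [← hL, div_le_iff₀ hn] at h1
    push_cast
    linarith

theorem tendsto_rpow_inv_of_geometric {A : ℕ → ℝ} {l c C : ℝ} (hl : 0 < l) (hc : 0 < c)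
    (hC : 0 < C) (h : ∀ n, c * l ^ n ≤ A n ∧ A n ≤ C * l ^ n) :
    Tendsto (fun n : ℕ => A n ^ (1 / (n : ℝ))) atTop (𝓝 l) := by
  have key : ∀ e : ℝ, 0 < e → Tendsto (fun n : ℕ => (e * l ^ n) ^ (1 / (n : ℝ))) atTop (𝓝 l) := by
    intro e he
    have h1 : Tendsto (fun n : ℕ => e ^ (1 / (n : ℝ)) * l) atTop (𝓝 (e ^ (0 : ℝ) * l)) :=
      ((tendsto_const_nhds.rpow tendsto_one_div_atTop_nhds_zero_nat (Or.inl he.ne'))).mul_const l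
    rw [Real.rpow_zero, one_mul] at h1
    refine h1.congr' ?_
    filter_upwards [eventually_ne_atTop 0] with n hn
    rw [Real.mul_rpow he.le (by positivity), one_div, Real.pow_rpow_inv_natCast hl.le hn]
  refine tendsto_of_tendsto_of_tendsto_of_le_of_le (key c hc) (key C hC) (fun n => ?_) fun n => ?_
  · exact Real.rpow_le_rpow (by positivity) (h n).1 (by positivity)
  · exact Real.rpow_le_rpow ((by positivity : 0 ≤ c * l ^ n).trans (h n).1) (h n).2 (by positivity)

/-! ### The leading eigenvalue -/

open Real (goldenRatio)

variable {P : Params}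

theorem transferOp_pow_apply (φ ψ : C(Lam P, ℝ)) (n : ℕ) (p : Lam P) :
    (transferOp φ ^ n) ψ p = (branchSum br (wt φ))^[n] ψ p := by
  induction n generalizing p with
  | zero => rfl
  | succ n ih =>
    rw [pow_succ', Function.iterate_succ_apply']
    change transferOp φ ((transferOp φ ^ n) ψ) p = _
    rw [transferOp_eq_branchSum]
    simp only [branchSum, ih]

theorem transferOp_pow_mono (φ : C(Lam P, ℝ)) {ψ ψ' : C(Lam P, ℝ)} (h0 : ∀ p, 0 ≤ ψ p)
    (h : ∀ p, ψ p ≤ ψ' p) (n : ℕ) (p : Lam P) :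
    (transferOp φ ^ n) ψ p ≤ (transferOp φ ^ n) ψ' p := by
  rw [transferOp_pow_apply, transferOp_pow_apply]
  exact branchSum_iterate_mono (wt_nonneg φ) (fun _ _ => le_rfl) h0 h n p

theorem iter_add (φ : C(Lam P, ℝ)) (n k : ℕ) :
    iter φ (n + k) = (transferOp φ ^ n) (iter φ k) := by
  rw [iter, iter, pow_add]
  rfl

/-- Positivity and |ψ| ≤ ‖ψ‖ · `perron`. The shift by ‖ψ‖ · `perron` makes the functions
nonnegative, as monotonicity is available only for those. -/
theorem abs_transferOp_pow_le (φ ψ : C(Lam P, ℝ)) (n : ℕ) (p : Lam P) :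
    |(transferOp φ ^ n) ψ p| ≤ ‖ψ‖ * iter φ n p := by
  have key : ∀ χ : C(Lam P, ℝ), ‖χ‖ ≤ ‖ψ‖ → (transferOp φ ^ n) χ p ≤ ‖ψ‖ * iter φ n p := by
    intro χ hχ
    have h1 := transferOp_pow_mono φ (ψ := χ + ‖ψ‖ • perron P) (ψ' := (2 * ‖ψ‖) • perron P)
      (fun q => by
        have h2 := neg_abs_le (χ q)
        have h3 := (χ.norm_coe_le_norm q).trans hχ
        rw [Real.norm_eq_abs] at h3
        have h4 := mul_le_mul_of_nonneg_left (one_le_perron q) (norm_nonneg ψ)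
        simp only [ContinuousMap.add_apply, ContinuousMap.smul_apply, smul_eq_mul]
        linarith)
      (fun q => by
        have h2 := le_abs_self (χ q)
        have h3 := (χ.norm_coe_le_norm q).trans hχ
        rw [Real.norm_eq_abs] at h3
        have h4 := mul_le_mul_of_nonneg_left (one_le_perron q) (norm_nonneg ψ)
        simp only [ContinuousMap.add_apply, ContinuousMap.smul_apply, smul_eq_mul]
        linarith) n p
    simp only [map_add, map_smul, ContinuousMap.add_apply, ContinuousMap.smul_apply,
      smul_eq_mul] at h1
    rw [← iter] at h1
    linarith
  refine abs_le.2 ⟨?_, key ψ le_rfl⟩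
  have h := key (-ψ) (norm_neg ψ).le
  rw [map_neg, ContinuousMap.neg_apply] at h
  linarith

theorem nonempty_Lam : Nonempty (Lam P) := by
  have h0 : ((0 : ℝ), (0 : ℝ), (0 : ℝ)) ∈ R₁ P :=
    ⟨⟨le_rfl, P.ρ_pos.le⟩, ⟨le_rfl, zero_le_one⟩, rfl⟩
  have hfix : Gmap P (0, 0, 0) = (0, 0, 0) := by
    rw [Gmap_R₁ h0]
    simp [g₀]
  refine ⟨⟨(0, 0, 0), mem_Lam.2 fun n => ?_⟩⟩
  rw [Function.iterate_fixed hfix n]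
  exact Or.inl (Or.inl h0)

/-- If the iterates are uniformly bounded below relative to their norm then they grow
geometrically, at the rate given by the spectral radius. -/
theorem exists_growth (φ : C(Lam P, ℝ)) {c : ℝ} (hc : 0 < c)
    (h : ∀ n p, c * ‖iter φ n‖ ≤ iter φ n p) :
    0 < spectralRad (transferOp φ) ∧ ∃ C : ℝ, 0 < C ∧ ∀ n,
      spectralRad (transferOp φ) ^ n ≤ ‖iter φ n‖ ∧
        ‖iter φ n‖ ≤ C * spectralRad (transferOp φ) ^ n := by
  have hω := Real.goldenRatio_pos
  obtain ⟨p₀⟩ := nonempty_Lam (P := P)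
  have ha : ∀ n, 0 < ‖iter φ n‖ := fun n => (iter_pos φ n p₀).trans_le (iter_le_norm φ n p₀)
  have hle : ∀ n k, ‖iter φ (n + k)‖ ≤ ‖iter φ n‖ * ‖iter φ k‖ := by
    intro n k
    refine (ContinuousMap.norm_le _ (by positivity)).2 fun p => ?_
    rw [Real.norm_of_nonneg (iter_pos φ _ p).le, iter_add]
    have h1 := abs_transferOp_pow_le φ (iter φ k) n p
    have h2 := mul_le_mul_of_nonneg_left (iter_le_norm φ n p) (ha k).le
    linarith [le_abs_self ((transferOp φ ^ n) (iter φ k) p)]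
  -- The k-th iterate is at least c times its norm and `perron` is at most ω, so it dominates a
  -- multiple of `perron`, to which n more steps are applied.
  have hge : ∀ n k, c / goldenRatio * (‖iter φ n‖ * ‖iter φ k‖) ≤ ‖iter φ (n + k)‖ := by
    intro n k
    have hpt : ∀ p, iter φ n p ≤ ‖iter φ (n + k)‖ / (c / goldenRatio * ‖iter φ k‖) := by
      intro p
      have h1 := transferOp_pow_mono φ (ψ := (c / goldenRatio * ‖iter φ k‖) • perron P)
        (ψ' := iter φ k)
        (fun q => by
          have := one_le_perron q
          simp only [ContinuousMap.smul_apply, smul_eq_mul]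
          positivity)
        (fun q => by
          simp only [ContinuousMap.smul_apply, smul_eq_mul]
          refine le_trans ?_ (h k q)
          calc c / goldenRatio * ‖iter φ k‖ * perron P q
              ≤ c / goldenRatio * ‖iter φ k‖ * goldenRatio := by
                gcongr
                exact perron_le q
            _ = c * ‖iter φ k‖ := by field_simp) n p
      simp only [map_smul, ContinuousMap.smul_apply, smul_eq_mul] at h1
      rw [← iter_add, ← iter] at h1
      have := ha k
      rw [le_div_iff₀' (by positivity)]
      exact h1.trans (iter_le_norm φ _ p)
    have h2 : ‖iter φ n‖ ≤ ‖iter φ (n + k)‖ / (c / goldenRatio * ‖iter φ k‖) := by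
      refine (ContinuousMap.norm_le _ (by positivity)).2 fun p => ?_
      rw [Real.norm_of_nonneg (iter_pos φ n p).le]
      exact hpt p
    have := ha k
    rw [le_div_iff₀ (by positivity)] at h2
    linarith
  obtain ⟨l, hl, hgrow⟩ := exists_geometric_of_almost_mul ha (d := c / goldenRatio)
    (by positivity) hle hge
  set C := goldenRatio / c with hC
  have hC0 : 0 < C := by positivity
  have hup : ∀ n, ‖iter φ n‖ ≤ C * l ^ n := by
    intro n
    have h1 := (hgrow n).2
    rw [hC, div_mul_eq_mul_div, le_div_iff₀ hc]
    rw [div_mul_eq_mul_div, div_le_iff₀ hω] at h1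
    linarith
  -- The operator norm of the n-th power lies between the norm of the n-th iterate divided by ω and
  -- that norm itself, so the limsup is a limit.
  have hr : spectralRad (transferOp φ) = l := by
    refine (tendsto_rpow_inv_of_geometric hl (c := 1 / goldenRatio) (by positivity) hC0
      fun n => ⟨?_, ?_⟩).limsup_eq
    · have h1 := (transferOp φ ^ n).le_opNorm (perron P)
      have h2 : ‖perron P‖ ≤ goldenRatio := by
        refine (ContinuousMap.norm_le _ hω.le).2 fun x => ?_
        rw [Real.norm_of_nonneg (zero_le_one.trans (one_le_perron x))]
        exact perron_le x
      have h3 := mul_le_mul_of_nonneg_left h2 (norm_nonneg (transferOp φ ^ n))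
      have h4 : l ^ n ≤ ‖(transferOp φ ^ n) (perron P)‖ := (hgrow n).1
      rw [one_div, inv_mul_le_iff₀ hω]
      linarith
    · refine ContinuousLinearMap.opNorm_le_bound _ (by positivity) fun ψ => ?_
      refine (ContinuousMap.norm_le _ (by positivity)).2 fun p => ?_
      refine (abs_transferOp_pow_le φ ψ n p).trans ?_
      rw [mul_comm]
      exact mul_le_mul_of_nonneg_right ((iter_le_norm φ n p).trans (hup n)) (norm_nonneg ψ)
  rw [hr]
  exact ⟨hl, C, hC0, fun n => ⟨(hgrow n).1, hup n⟩⟩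

/-! ### The eigenfunction and the eigenmeasure -/

theorem holderWith_of_abs_sub_le {X : Type*} [MetricSpace X] {u : X → ℝ} {C r : ℝ} (hC : 0 ≤ C)
    (hr : 0 ≤ r) (h : ∀ x y, |u x - u y| ≤ C * dist x y ^ r) :
    HolderWith C.toNNReal r.toNNReal u := by
  intro x y
  rw [edist_nndist, edist_nndist, ← ENNReal.coe_rpow_of_nonneg _ (NNReal.coe_nonneg _),
    ← ENNReal.coe_mul, ENNReal.coe_le_coe, ← NNReal.coe_le_coe]
  push_cast
  rw [Real.coe_toNNReal _ hC, Real.coe_toNNReal _ hr, Real.dist_eq]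
  exact h x y

/-- A positive Hölder continuous eigenfunction. -/
theorem exists_eigenfunction (φ : C(Lam P, ℝ)) {l c C D r : ℝ} (hl : 0 < l) (hc : 0 < c)
    (hD : 0 ≤ D) (hr0 : 0 < r) (hr1 : r ≤ 1)
    (hlow : ∀ n p, c * l ^ n ≤ iter φ n p) (hup : ∀ n, ‖iter φ n‖ ≤ C * l ^ n)
    (hhol : ∀ n p q, |iter φ n p - iter φ n q| ≤ D * ‖iter φ n‖ * dist p q ^ r) :
    ∃ h : C(Lam P, ℝ), (∀ x, 0 < h x) ∧ IsHolder h ∧ transferOp φ h = l • h := by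
  have hmem : ∀ p n, iter φ n p / l ^ n ∈ Set.Icc c C := by
    intro p n
    have hln : 0 < l ^ n := pow_pos hl n
    exact ⟨(le_div_iff₀ hln).2 (hlow n p),
      (div_le_iff₀ hln).2 ((iter_le_norm φ n p).trans (hup n))⟩
  have hC0 : 0 ≤ C := by
    obtain ⟨p₀⟩ := nonempty_Lam (P := P)
    exact hc.le.trans ((hmem p₀ 0).1.trans (hmem p₀ 0).2)
  set h₀ : Lam P → ℝ := fun p => cesaroLim fun n => iter φ n p / l ^ n with hh₀
  have hle : ∀ p q, |h₀ p - h₀ q| ≤ D * C * dist p q ^ r := by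
    intro p q
    have e := cesaroLim_add_mul (hmem p) (hmem q) 1 (-1)
    have hd : 0 ≤ dist p q ^ r := Real.rpow_nonneg dist_nonneg _
    have h1 := cesaroLim_mem_Icc
      (u := fun n => 1 * (iter φ n p / l ^ n) + -1 * (iter φ n q / l ^ n))
      (a := -(D * C * dist p q ^ r)) (b := D * C * dist p q ^ r) fun n => by
        have hln : 0 < l ^ n := pow_pos hl n
        have h2 : |iter φ n p - iter φ n q| ≤ D * C * dist p q ^ r * l ^ n := by
          refine (hhol n p q).trans ?_
          have h3 := mul_le_mul_of_nonneg_left (hup n) (mul_nonneg hD hd)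
          linarith
        rw [← abs_of_pos hln, ← div_le_iff₀ (abs_pos.2 hln.ne'), ← abs_div] at h2
        have h4 : 1 * (iter φ n p / l ^ n) + -1 * (iter φ n q / l ^ n)
            = (iter φ n p - iter φ n q) / l ^ n := by ring
        rw [h4]
        exact abs_le.1 h2
    rw [e] at h1
    rw [one_mul, neg_one_mul, ← sub_eq_add_neg] at h1
    exact abs_le.2 h1
  have hH := holderWith_of_abs_sub_le (mul_nonneg hD hC0) hr0.le hle
  have hr : 0 < r.toNNReal := Real.toNNReal_pos.2 hr0
  refine ⟨⟨h₀, hH.continuous hr⟩, fun x => hc.trans_le (cesaroLim_mem_Icc (hmem x)).1,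
    ⟨_, _, hr, Real.toNNReal_le_one.2 hr1, hH⟩, ?_⟩
  ext p
  rw [transferOp_eq_branchSum]
  change branchSum br (wt φ) h₀ p = l * h₀ p
  have e1 := cesaroLim_add_mul (hmem (br true p)) (hmem (br false p))
    (wt φ true p) (wt φ false p)
  -- The operator shifts the normalized sequence and multiplies it by l. The summand with
  -- coefficient 0 only gives the two-term shape of `cesaroLim_add_mul`.
  have e2 : (fun n => wt φ true p * (iter φ n (br true p) / l ^ n)
      + wt φ false p * (iter φ n (br false p) / l ^ n))
      = fun n => l * (iter φ (n + 1) p / l ^ (n + 1)) + 0 * (iter φ (n + 1) p / l ^ (n + 1)) := by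
    funext n
    rw [iter_succ_apply, branchSum, pow_succ]
    field_simp
    ring
  rw [e2, cesaroLim_add_mul (fun n => hmem p (n + 1)) (fun n => hmem p (n + 1)),
    cesaroLim_succ (hmem p)] at e1
  rw [branchSum]
  linarith

open MeasureTheory CompactlySupported in
/-- A positive linear functional on `C(Λ)` that is an eigenvector of the dual operator gives rise
to an eigenmeasure. -/
theorem exists_eigenmeasure_of_functional (φ : C(Lam P, ℝ)) {l : ℝ} (hl : 0 ≤ l)
    (T : C(Lam P, ℝ) →ₗ[ℝ] ℝ) (hT : ∀ ψ : C(Lam P, ℝ), (∀ x, 0 ≤ ψ x) → 0 ≤ T ψ) (hT1 : 0 < T 1)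
    (hTl : ∀ ψ, T (transferOp φ ψ) = l * T ψ) :
    ∃ ν : Measure (Lam P), IsProbabilityMeasure ν ∧ IsDualTransfer φ ν (ENNReal.ofReal l • ν) := by
  let incl : C_c(Lam P, ℝ) →ₗ[ℝ] C(Lam P, ℝ) :=
    { toFun := fun g => g.toContinuousMap
      map_add' := fun _ _ => rfl
      map_smul' := fun _ _ => rfl }
  -- Division by T 1 makes the Riesz measure a probability measure.
  let S : C_c(Lam P, ℝ) →ₚ[ℝ] ℝ := PositiveLinearMap.mk₀ ((T 1)⁻¹ • T.comp incl) fun g hg =>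
    mul_nonneg (inv_nonneg.2 hT1.le) (hT _ fun x => hg x)
  have hint : ∀ ψ : C(Lam P, ℝ), ∫ x, ψ x ∂(RealRMK.rieszMeasure S) = (T 1)⁻¹ * T ψ := fun ψ =>
    RealRMK.integral_rieszMeasure S (CompactlySupportedContinuousMap.continuousMapEquiv ψ)
  refine ⟨RealRMK.rieszMeasure S, ⟨?_⟩, fun ψ => ?_⟩
  · have h1 := hint 1
    simp only [ContinuousMap.one_apply, integral_const, smul_eq_mul, mul_one,
      inv_mul_cancel₀ hT1.ne'] at h1
    exact (ENNReal.toReal_eq_one_iff _).1 h1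
  · rw [integral_smul_measure, hint, hint, hTl, ENNReal.toReal_ofReal hl, smul_eq_mul]
    ring

open MeasureTheory in
/-- An eigenmeasure of the dual operator. -/
theorem exists_eigenmeasure (φ : C(Lam P, ℝ)) {l c C : ℝ} (hl : 0 < l) (hc : 0 < c)
    (hlow : ∀ n p, c * l ^ n ≤ iter φ n p) (hup : ∀ n, ‖iter φ n‖ ≤ C * l ^ n) :
    ∃ ν : Measure (Lam P), IsProbabilityMeasure ν ∧ IsDualTransfer φ ν (ENNReal.ofReal l • ν) := by
  obtain ⟨p₀⟩ := nonempty_Lam (P := P)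
  have hω := Real.goldenRatio_pos
  have hmem : ∀ (ψ : C(Lam P, ℝ)) n,
      (transferOp φ ^ n) ψ p₀ / l ^ n ∈ Set.Icc (-(‖ψ‖ * C)) (‖ψ‖ * C) := by
    intro ψ n
    have hln : 0 < l ^ n := pow_pos hl n
    have h1 := (abs_transferOp_pow_le φ ψ n p₀).trans (mul_le_mul_of_nonneg_left
      ((iter_le_norm φ n p₀).trans (hup n)) (norm_nonneg ψ))
    rw [← mul_assoc, ← abs_of_pos hln, ← div_le_iff₀ (abs_pos.2 hln.ne'), ← abs_div] at h1
    exact abs_le.1 h1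
  let T : C(Lam P, ℝ) →ₗ[ℝ] ℝ :=
    { toFun := fun ψ => cesaroLim fun n => (transferOp φ ^ n) ψ p₀ / l ^ n
      map_add' := fun ψ₁ ψ₂ => by
        have e := cesaroLim_add_mul (hmem ψ₁) (hmem ψ₂) 1 1
        simp only [one_mul] at e
        rw [← e]
        simp only [map_add, ContinuousMap.add_apply, add_div]
      map_smul' := fun a ψ => by
        have e := cesaroLim_add_mul (hmem ψ) (hmem ψ) a 0
        simp only [zero_mul, add_zero] at e
        simp only [map_smul, ContinuousMap.smul_apply, smul_eq_mul, mul_div_assoc, e,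
          RingHom.id_apply] }
  have hTapp : ∀ ψ, T ψ = cesaroLim fun n => (transferOp φ ^ n) ψ p₀ / l ^ n := fun _ => rfl
  refine exists_eigenmeasure_of_functional φ hl.le T (fun ψ hψ => ?_) ?_ fun ψ => ?_
  · rw [hTapp]
    refine (cesaroLim_mem_Icc (b := ‖ψ‖ * C) fun n => ⟨?_, (hmem ψ n).2⟩).1
    rw [transferOp_pow_apply]
    exact div_nonneg (branchSum_iterate_nonneg (wt_nonneg φ) hψ n p₀) (pow_nonneg hl.le n)
  · rw [hTapp]
    -- Since ω · 1 ≥ `perron`, the normalized images of 1 inherit the lower bound of the iterates.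
    refine lt_of_lt_of_le (show 0 < c / Real.goldenRatio by positivity)
      (cesaroLim_mem_Icc (b := ‖(1 : C(Lam P, ℝ))‖ * C) fun n => ⟨?_, (hmem 1 n).2⟩).1
    have hln : 0 < l ^ n := pow_pos hl n
    have h1 := transferOp_pow_mono φ (ψ := perron P) (ψ' := Real.goldenRatio • 1)
      (fun q => zero_le_one.trans (one_le_perron q))
      (fun q => by simpa using perron_le q) n p₀
    rw [map_smul, ContinuousMap.smul_apply, smul_eq_mul, ← iter] at h1
    rw [div_le_div_iff₀ hω hln]
    linarith [hlow n p₀]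
  · have e : (fun n => (transferOp φ ^ n) (transferOp φ ψ) p₀ / l ^ n)
        = fun n => l * ((transferOp φ ^ (n + 1)) ψ p₀ / l ^ (n + 1))
          + 0 * ((transferOp φ ^ (n + 1)) ψ p₀ / l ^ (n + 1)) := by
      funext n
      have h1 : (transferOp φ ^ (n + 1)) ψ = (transferOp φ ^ n) (transferOp φ ψ) := by
        rw [pow_succ]
        rfl
      rw [h1, pow_succ]
      field_simp
      ring
    rw [hTapp, hTapp, e, cesaroLim_add_mul (fun n => hmem ψ (n + 1)) (fun n => hmem ψ (n + 1)),
      cesaroLim_succ (hmem ψ)]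
    ring

/-- A Hölder exponent can be lowered, since `Λ` has diameter at most one. -/
theorem IsHolder.exists_abs_sub_le {u : Lam P → ℝ} (hu : IsHolder u) :
    ∃ K r : ℝ, 0 ≤ K ∧ 0 < r ∧ r ≤ 1 / 10 ∧ ∀ p q, |u p - u q| ≤ K * dist p q ^ r := by
  obtain ⟨K, s, hs, -, h⟩ := hu
  refine ⟨K, min s (1 / 10), K.2, lt_min hs (by norm_num), min_le_right _ _, fun p q => ?_⟩
  have h1 := h.dist_le p q
  rw [Real.dist_eq] at h1
  refine h1.trans (mul_le_mul_of_nonneg_left ?_ K.2)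
  -- Lowering an exponent needs a positive base; at distance 0 the original power vanishes.
  rcases eq_or_lt_of_le (dist_nonneg (x := p) (y := q)) with h0 | h0
  · rw [← h0, Real.zero_rpow (by exact_mod_cast hs.ne')]
    exact Real.rpow_nonneg le_rfl _
  · exact Real.rpow_le_rpow_of_exponent_ge h0 (dist_le_one p q) (min_le_left _ _)

end HorseshoeProjection

theorem theoremB (P : HorseshoeProjection.Params)
    (φ : C(HorseshoeProjection.Lam P, ℝ))
    (hφ : HorseshoeProjection.IsHolder φ)
    (hvar : (⨆ x, φ x) - (⨅ x, φ x) < Real.log ((1 + Real.sqrt 5) / 2) / 2) :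
    ∃ (ν : MeasureTheory.Measure (HorseshoeProjection.Lam P))
      (h : C(HorseshoeProjection.Lam P, ℝ)),
      MeasureTheory.IsProbabilityMeasure ν ∧
      HorseshoeProjection.IsDualTransfer φ ν
        (ENNReal.ofReal
          (HorseshoeProjection.spectralRad (HorseshoeProjection.transferOp φ)) • ν) ∧
      (∀ x, 0 < h x) ∧
      HorseshoeProjection.IsHolder h ∧
      HorseshoeProjection.transferOp φ h
        = HorseshoeProjection.spectralRad (HorseshoeProjection.transferOp φ) • h := by
  obtain ⟨K, r, hK, hr0, hr1, hKr⟩ := hφ.exists_abs_sub_le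
  obtain ⟨⟨D, hD, hhol⟩, c, hc, hbelow⟩ :=
    HorseshoeProjection.exists_iter_bounds φ hvar hKr hK hr0 hr1
  obtain ⟨hl, C, -, hgrow⟩ := HorseshoeProjection.exists_growth φ hc hbelow
  have hlow : ∀ n p, c * HorseshoeProjection.spectralRad (HorseshoeProjection.transferOp φ) ^ n
      ≤ HorseshoeProjection.iter φ n p := fun n p =>
    (mul_le_mul_of_nonneg_left (hgrow n).1 hc.le).trans (hbelow n p)
  obtain ⟨h, hpos, hh, heig⟩ := HorseshoeProjection.exists_eigenfunction φ hl hc hD hr0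
    (by linarith) hlow (fun n => (hgrow n).2) hhol
  obtain ⟨ν, hν, hdual⟩ :=
    HorseshoeProjection.exists_eigenmeasure φ hl hc hlow fun n => (hgrow n).2
  exact ⟨ν, h, hν, hdual, hpos, hh, heig⟩
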